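/- Let $S=(S_1,\dots,S_N)$ and $X=(X_1,\dots,X_N)$ be random vectors with finite alphabets, the $X_j$ being real-valued, such that the pairs $(S_j,X_j)$ are independent: $P_{SX}(s,x)=\prod_{j=1}^N P_{S_jX_j}(s_j,x_j)$. For $i=1,\dots,L$ let the $i$-th task be $h_i(X)=A_iX^{T}$, where $A_i\in\mathbb{R}^{N\times N}$ has at most one non-zero entry in each row and in each column, each non-zero entry being equal to one; thus $h_i(X)$ represents a sub-collection of the components of $X$. Let $C_i\subseteq\{1,\dots,N\}$ be the set of indices $j$ for which $X_j$ is a component of $h_i(X)$ (the $j$-th column of $A_i$ is non-zero). Let $f$ be a real-valued function of $X$ (the semantic) and $\varepsilon\in\mathbb{R}$. Call $U$ feasible if $U=f(X)+M$, where the discrete real-valued noise $M$ is drawn from some conditional distribution $P_{M|S,f(X),h_1(X),\dots,h_L(X)}$ and $I(S;U)\le\varepsilon$. Logarithms are to base $2$, and entropies and mutual informations are measured in bits. For every feasible $U$ there is a vector of discrete random variables $U^*=(U^*_1,\dots,U^*_N)$, jointly distributed with $(S,X)$, whose conditional distribution factorizes as $$P_{U^*|XS}(u^*|x,s)=\prod_{j=1}^N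 P_{U^*_j|X_jS_j}(u^*_j|x_j,s_j),$$ which has the same leakage as $U$, $$I(S;U^*)=I(S;U),$$ and which satisfies, for all $i\in\{1,\dots,L\}$, $$I(h_i(X);U)\le I(h_i(X);U^*)+\min\{\Delta_i^1,\Delta_i^2\},$$ where $$\Delta_i^1=I(S;h_i(X))+\sum_{j\in C_i}H(S_j|X_j)=\sum_{j\in C_i}\bigl(I(S_j;X_j)+H(S_j|X_j)\bigr),$$ $$\Delta_i^2=I(S;h_i(X))+\sum_{j\in C_i}\bigl(\log(I(S_j;X_j)+1)+4\bigr)=\sum_{j\in C_i}\bigl(I(S_j;X_j)+\log(I(S_j;X_j)+1)+4\bigr).$$ -/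

import Mathlib

namespace SemanticPrivacy

noncomputable section

open scoped Matrix

/-- Mutual information `I(A; B)`, in bits, of two discrete random variables `A`, `B` on the discrete
probability space `(Ω, P)`:
the sum over `(a, b)` of `P(A=a, B=b) log₂ (P(A=a, B=b) / (P(A=a) P(B=b)))`.
The sum is absolutely convergent as soon as one of `A`, `B` takes finitely many values. -/
def mutualInfo {Ω α β : Type*} (P : PMF Ω) (A : Ω → α) (B : Ω → β) : ℝ :=
  ∑' ab : α × β,
    ((P.map fun ω => (A ω, B ω)) ab).toReal *
      Real.logb 2 (((P.map fun ω => (A ω, B ω)) ab).toReal /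
        (((P.map A) ab.1).toReal * ((P.map B) ab.2).toReal))

/-- Conditional entropy `H(A | B)`, in bits:
the sum over `(a, b)` of `P(A=a, B=b) log₂ (1 / P(A=a | B=b))`. -/
def condEntropy {Ω α β : Type*} (P : PMF Ω) (A : Ω → α) (B : Ω → β) : ℝ :=
  ∑' ab : α × β,
    ((P.map fun ω => (A ω, B ω)) ab).toReal *
      Real.logb 2 (((P.map B) ab.2).toReal /
        ((P.map fun ω => (A ω, B ω)) ab).toReal)

/-- The joint law of `(Z, U)` when `Z` has law `P` and `U` given `Z = z` has law `K z`. -/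
def jointLaw {Z 𝒰 : Type*} (P : PMF Z) (K : Z → PMF 𝒰) : PMF (Z × 𝒰) :=
  P.bind fun z => (K z).map fun u => (z, u)

/-- Values of the private data `S = (S_1, …, S_N)` together with the source `X = (X_1, …, X_N)`,
where `S_i` has alphabet `𝒮 i` and `X_i` has the finite alphabet `𝒳 i` of real numbers. -/
abbrev Source {N : ℕ} (𝒮 : Fin N → Type*) (𝒳 : Fin N → Finset ℝ) : Type _ :=
  (∀ i, 𝒮 i) × (∀ i, 𝒳 i)

/-- `P_{SX}(s, x) = ∏ i, P_{S_i X_i}(s_i, x_i)`. -/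
def IndependentPairs {N : ℕ} {𝒮 : Fin N → Type*} {𝒳 : Fin N → Finset ℝ}
    (P : PMF (Source 𝒮 𝒳)) : Prop :=
  ∀ (s : ∀ i, 𝒮 i) (x : ∀ i, 𝒳 i),
    P (s, x) = ∏ i, (P.map fun ω => (ω.1 i, ω.2 i)) (s i, x i)

/-- A matrix with at most one non-zero entry in each row and in each column, each non-zero entry
being equal to one. -/
structure IsSelection {N : ℕ} (A : Matrix (Fin N) (Fin N) ℝ) : Prop where
  eq_one : ∀ r c, A r c ≠ 0 → A r c = 1
  row : ∀ r c c', A r c ≠ 0 → A r c' ≠ 0 → c = c'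
  col : ∀ r r' c, A r c ≠ 0 → A r' c ≠ 0 → r = r'

/-- The task `h(x) = A xᵀ`. -/
def task {N : ℕ} {𝒳 : Fin N → Finset ℝ} (A : Matrix (Fin N) (Fin N) ℝ) (x : ∀ i, 𝒳 i) :
    Fin N → ℝ :=
  A *ᵥ fun j => (x j : ℝ)

open Classical in
/-- The set of the indices `j` such that `X_j` is one of the components of `A Xᵀ`. -/
def selected {N : ℕ} (A : Matrix (Fin N) (Fin N) ℝ) : Finset (Fin N) :=
  Finset.univ.filter fun j => ∃ r, A r j ≠ 0

/-- The joint law of `(S, X, U)`, where `U = f(X) + M` and the discrete noise `M` has the conditional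
distribution `W = P_{M | S, f(X), h(X)}`, with `h(X) = (A_1 Xᵀ, …, A_L Xᵀ)`. -/
def disclosure {N L : ℕ} {𝒮 : Fin N → Type*} {𝒳 : Fin N → Finset ℝ}
    (P : PMF (Source 𝒮 𝒳)) (f : (∀ i, 𝒳 i) → ℝ) (A : Fin L → Matrix (Fin N) (Fin N) ℝ)
    (W : (∀ i, 𝒮 i) → ℝ → (Fin L → Fin N → ℝ) → PMF ℝ) : PMF (Source 𝒮 𝒳 × ℝ) :=
  jointLaw P fun ω => (W ω.1 (f ω.2) fun i => task (A i) ω.2).map fun m => f ω.2 + m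

/-- The leakage `I(S; U)` under a joint law of `(S, X, U)`. -/
def leakage {N : ℕ} {𝒮 : Fin N → Type*} {𝒳 : Fin N → Finset ℝ} {𝒰 : Type*}
    (Q : PMF (Source 𝒮 𝒳 × 𝒰)) : ℝ :=
  mutualInfo Q (fun q => q.1.1) (fun q => q.2)

/-- The utility `I(A Xᵀ; U)` of the task `A` under a joint law of `(S, X, U)`. -/
def utility {N : ℕ} {𝒮 : Fin N → Type*} {𝒳 : Fin N → Finset ℝ} {𝒰 : Type*}
    (Q : PMF (Source 𝒮 𝒳 × 𝒰)) (A : Matrix (Fin N) (Fin N) ℝ) : ℝ :=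
  mutualInfo Q (fun q => task A q.1.2) (fun q => q.2)

/-- The noise distribution `W` is feasible at level `ε`: `I(S; f(X) + M) ≤ ε`. -/
def Feasible {N L : ℕ} {𝒮 : Fin N → Type*} {𝒳 : Fin N → Finset ℝ}
    (P : PMF (Source 𝒮 𝒳)) (f : (∀ i, 𝒳 i) → ℝ) (A : Fin L → Matrix (Fin N) (Fin N) ℝ)
    (ε : ℝ) (W : (∀ i, 𝒮 i) → ℝ → (Fin L → Fin N → ℝ) → PMF ℝ) : Prop :=
  leakage (disclosure P f A W) ≤ ε

/-- `I(S_j; X_j)`. -/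
def pairInfo {N : ℕ} {𝒮 : Fin N → Type*} {𝒳 : Fin N → Finset ℝ}
    (P : PMF (Source 𝒮 𝒳)) (j : Fin N) : ℝ :=
  mutualInfo P (fun ω => ω.1 j) (fun ω => ω.2 j)

/-- `H(S_j | X_j)`. -/
def pairCondEntropy {N : ℕ} {𝒮 : Fin N → Type*} {𝒳 : Fin N → Finset ℝ}
    (P : PMF (Source 𝒮 𝒳)) (j : Fin N) : ℝ :=
  condEntropy P (fun ω => ω.1 j) (fun ω => ω.2 j)

/-- `Δ¹ = I(S; h(X)) + ∑_{j : X_j ∈ h(X)} H(S_j | X_j)` for the task `h(X) = A Xᵀ`. -/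
def gapOne {N : ℕ} {𝒮 : Fin N → Type*} {𝒳 : Fin N → Finset ℝ}
    (P : PMF (Source 𝒮 𝒳)) (A : Matrix (Fin N) (Fin N) ℝ) : ℝ :=
  mutualInfo P (fun ω => ω.1) (fun ω => task A ω.2) + ∑ j ∈ selected A, pairCondEntropy P j

/-- `Δ² = I(S; h(X)) + ∑_{j : X_j ∈ h(X)} (log₂ (I(S_j; X_j) + 1) + 4)` for the task
`h(X) = A Xᵀ`. -/
def gapTwo {N : ℕ} {𝒮 : Fin N → Type*} {𝒳 : Fin N → Finset ℝ}
    (P : PMF (Source 𝒮 𝒳)) (A : Matrix (Fin N) (Fin N) ℝ) : ℝ :=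
  mutualInfo P (fun ω => ω.1) (fun ω => task A ω.2) +
    ∑ j ∈ selected A, (Real.logb 2 (pairInfo P j + 1) + 4)

end

end SemanticPrivacy

namespace SemanticPrivacy

/-! ### Exponential races over a finite alphabet. -/

section Race

open MeasureTheory ProbabilityTheory
open scoped ENNReal

/-! Only two facts about the given `U` matter: `0 ≤ I(S;U) ≤ H(S)`, and `I(h_i(X);U) ≤ H(h_i(X)) =
∑_{j ∈ C_i} H(X_j)`. It therefore suffices to build, letter by letter, a `U*_j` that leaks a
prescribed fraction `a` of `H(S_j)` and leaves little uncertainty about `X_j`; the choice `a =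
I(S;U) / H(S)` matches the total leakage, and independence of the pairs makes all quantities
additive.

For one letter, write `X = Z(S)` with `Z` a random function independent of `S`, and disclose `(Z,
W)`, where `W` is `S` with probability `a` and erased otherwise. Then `I(S;Z,W) = a H(S)`. An
unerased `W` determines `X`, so `H(X|Z,W) = (1-a) H(X|Z) ≤ H(X|Z)`. Since `X = Z(S)`, this is at
most `H(S) = I(S;X) + H(S|X)`, which gives the first gap. The second needs a good `Z`, with `H(X|Z)
≤ I + log (I+1) + 2`, where `I = I(S;X)`: the strong functional representation lemma
(`exists_functional_representation`).

That `Z` comes from an exponential race. With i.i.d. rate-one clocks `e_y`, let `Z(s)` minimize `e_y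
/ p(y|s)`. The winner has law `p(·|s)`, and given that `y` wins, `e_y` has mean `p(y|s)`
(`lintegral_wins`, `setIntegral_wins`). To bound the entropy of `Z(S)` for fixed clocks, apply
Gibbs' inequality with weights `δ (1 + e_y/m_y)^(-(1+δ))`, where `m` is the law of `X`; their
expected total is at most one. Concavity of the logarithm replaces `e_y/m_y` by its conditional mean
`p(y|s)/m_y`, and what remains is essentially the mutual information (`exists_random_function`). -/

instance isProbabilityMeasure_expMeasure_one : IsProbabilityMeasure (expMeasure 1) :=
  isProbabilityMeasure_expMeasure one_pos

theorem expMeasure_one_Ioi {a : ℝ} (ha : 0 ≤ a) :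
    expMeasure 1 (Set.Ioi a) = ENNReal.ofReal (Real.exp (-a)) := by
  have h := cdf_expMeasure_eq one_pos a
  rw [cdf_eq_real, if_pos ha, one_mul] at h
  rw [← Set.compl_Iic, ← ofReal_measureReal, probReal_compl_eq_one_sub measurableSet_Iic, h]
  congr 1
  ring

theorem lintegral_expMeasure {r : ℝ} (G : ℝ → ℝ≥0∞) (hG : Measurable G) :
    ∫⁻ t, G t ∂(expMeasure r) =
      ∫⁻ t in Set.Ioi 0, ENNReal.ofReal (r * Real.exp (-(r * t))) * G t := by
  have hm : Measurable (exponentialPDF r) :=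
    (measurable_exponentialPDFReal r).ennreal_ofReal
  have h0 : expMeasure r = volume.withDensity (exponentialPDF r) := rfl
  rw [h0, lintegral_withDensity_eq_lintegral_mul _ hm hG, setLIntegral_congr Ioi_ae_eq_Ici,
    ← lintegral_indicator measurableSet_Ici]
  refine lintegral_congr fun t => ?_
  by_cases ht : 0 ≤ t
  · simp [ht, exponentialPDF_of_nonneg ht]
  · simp [ht, exponentialPDF_of_neg (not_le.1 ht)]

variable {ι : Type*} [Fintype ι]

/-- The law of a family of independent exponential random variables of rate one. -/
noncomputable def clocks (ι : Type*) [Fintype ι] : Measure (ι → ℝ) :=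
  Measure.pi fun _ => expMeasure 1

instance isProbabilityMeasure_clocks : IsProbabilityMeasure (clocks ι) := by
  unfold clocks; infer_instance

/-- The event that `y` is the strict minimizer of `e y / p y`. -/
def wins {ι : Type*} (p : ι → ℝ) (y : ι) : Set (ι → ℝ) := {e | ∀ i, i ≠ y → p i * e y < p y * e i}

theorem measurableSet_wins {ι : Type*} [Countable ι] (p : ι → ℝ) (y : ι) : MeasurableSet (wins p y) := by
  have : wins p y = ⋂ i, ⋂ (_ : i ≠ y), {e : ι → ℝ | p i * e y < p y * e i} := by
    ext e; simp [wins]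
  rw [this]
  exact MeasurableSet.iInter fun i => MeasurableSet.iInter fun _ =>
    measurableSet_lt (by fun_prop) (by fun_prop)

theorem wins_inj {ι : Type*} {p : ι → ℝ} {y y' : ι} {e : ι → ℝ} (h : e ∈ wins p y) (h' : e ∈ wins p y') :
    y = y' := by
  by_contra hne
  exact lt_asymm (h y' (Ne.symm hne)) (h' y hne)

theorem lintegral_clocks_eval (y : ι) (G : ℝ → ℝ≥0∞) (hG : Measurable G) :
    ∫⁻ e, G (e y) ∂(clocks ι) = ∫⁻ t, G t ∂(expMeasure 1) :=
  (measurePreserving_eval (fun _ : ι => expMeasure 1) y).lintegral_comp hG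

theorem ae_clocks_pos : ∀ᵐ e ∂(clocks ι), ∀ y, 0 < e y := by
  rw [ae_all_iff]
  intro y
  have h : ∀ᵐ t ∂(expMeasure 1), t ∈ Set.Ioi (0 : ℝ) := by
    refine (mem_ae_iff_prob_eq_one measurableSet_Ioi).2 ?_
    rw [expMeasure_one_Ioi le_rfl]
    simp
  exact (measurePreserving_eval (fun _ : ι => expMeasure 1) y).quasiMeasurePreserving.ae h

/-- Given `e y = t`, each rival `i` must exceed `p i * t / p y`. The rivals are independent, so this
has probability `exp (-(1 - p y) t / p y)`; multiplied by the density `exp (-t)` it gives `exp (-t /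
p y)`, which is `p y` times the density of rate `1 / p y`. -/
theorem lintegral_wins {p : ι → ℝ} (hp : ∀ i, 0 ≤ p i) (hp1 : ∑ i, p i = 1) {y : ι}
    (hy : 0 < p y) (G : ℝ → ℝ≥0∞) (hG : Measurable G) :
    ∫⁻ e in wins p y, G (e y) ∂(clocks ι) =
      ENNReal.ofReal (p y) * ∫⁻ t, G t ∂(expMeasure (p y)⁻¹) := by
  classical
  set T : Finset ι := Finset.univ.erase y with hT
  have hind : IndepFun (fun (e : ι → ℝ) (i : ({y} : Finset ι)) => e i)
      (fun (e : ι → ℝ) (i : T) => e i) (clocks ι) := by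
    refine iIndepFun.indepFun_finset {y} T (by simp [hT]) ?_ fun i => measurable_pi_apply i
    exact iIndepFun_pi (X := fun _ => id) (fun _ => aemeasurable_id)
  have hind' : IndepFun (fun e : ι → ℝ => e y) (fun (e : ι → ℝ) (i : T) => e i) (clocks ι) :=
    IndepFun.comp (φ := fun v : ({y} : Finset ι) → ℝ => v ⟨y, by simp⟩) (ψ := id) hind
      (measurable_pi_apply _) measurable_id
  have hY : Measurable fun (e : ι → ℝ) (i : T) => e i := by fun_prop
  have hmap := (indepFun_iff_map_prod_eq_prod_map_map
    (measurable_pi_apply y).aemeasurable hY.aemeasurable).1 hind'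
  have hey : (clocks ι).map (fun e => e y) = expMeasure 1 :=
    (measurePreserving_eval (fun _ : ι => expMeasure 1) y).map_eq
  rw [hey] at hmap
  set D : Set (ℝ × (T → ℝ)) := {q | ∀ i : T, p i * q.1 < p y * q.2 i} with hD
  have hDm : MeasurableSet D := by
    have : D = ⋂ i : T, {q | p i * q.1 < p y * q.2 i} := by ext; simp [hD]
    rw [this]
    exact MeasurableSet.iInter fun i => measurableSet_lt (by fun_prop) (by fun_prop)
  have hw : wins p y = (fun e : ι → ℝ => (e y, fun i : T => e i)) ⁻¹' D := by
    ext e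
    simp [wins, hD, hT]
  have hF : Measurable (D.indicator fun q : ℝ × (T → ℝ) => G q.1) :=
    (hG.comp measurable_fst).indicator hDm
  have h1 : ∫⁻ e in wins p y, G (e y) ∂(clocks ι) =
      ∫⁻ q, D.indicator (fun q : ℝ × (T → ℝ) => G q.1) q
        ∂((clocks ι).map fun e : ι → ℝ => (e y, fun i : T => e i)) := by
    rw [lintegral_map hF (by fun_prop), ← lintegral_indicator (measurableSet_wins p y)]
    refine lintegral_congr fun e => ?_
    rw [hw]
    rfl
  rw [h1, hmap, lintegral_prod _ hF.aemeasurable, lintegral_expMeasure _ hF.lintegral_prod_right',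
    lintegral_expMeasure _ hG, ← lintegral_const_mul' _ _ ENNReal.ofReal_ne_top]
  refine setLIntegral_congr_fun measurableSet_Ioi fun t ht => ?_
  have ht0 : (0 : ℝ) < t := ht
  have hDt : MeasurableSet {v : T → ℝ | (t, v) ∈ D} := measurable_prodMk_left hDm
  have h2 : ∫⁻ v, D.indicator (fun q : ℝ × (T → ℝ) => G q.1) (t, v)
      ∂((clocks ι).map fun (e : ι → ℝ) (i : T) => e i) =
      G t * ENNReal.ofReal (Real.exp (-((1 - p y) / p y * t))) := by
    have : ∀ v, D.indicator (fun q : ℝ × (T → ℝ) => G q.1) (t, v) =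
        {v : T → ℝ | (t, v) ∈ D}.indicator (fun _ => G t) v := fun v => rfl
    simp_rw [this]
    rw [lintegral_indicator_const hDt, Measure.map_apply hY hDt]
    congr 1
    -- The section is a box; the unused coordinate `y` receives the factor `univ`, of mass one.
    have h3 : (fun (e : ι → ℝ) (i : T) => e i) ⁻¹' {v : T → ℝ | (t, v) ∈ D} =
        Set.univ.pi fun i => if i = y then Set.univ else Set.Ioi (p i / p y * t) := by
      ext e
      simp only [hD, hT, Set.mem_preimage, Set.mem_ofPred_eq, Subtype.forall, Finset.mem_erase,
        Finset.mem_univ, and_true, Set.mem_pi]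
      refine forall_congr' fun i => ?_
      by_cases hi : i = y
      · simp [hi]
      · simp only [hi, not_false_eq_true, true_implies, if_false, Set.mem_Ioi, ne_eq]
        rw [div_mul_eq_mul_div, div_lt_iff₀ hy, mul_comm (e i)]
        simp
    rw [h3, clocks, Measure.pi_pi, ← Finset.mul_prod_erase _ _ (Finset.mem_univ y)]
    have h4 : ∀ i ∈ Finset.univ.erase y,
        expMeasure 1 (if i = y then Set.univ else Set.Ioi (p i / p y * t)) =
          ENNReal.ofReal (Real.exp (-(p i / p y * t))) := by
      intro i hi
      rw [if_neg (Finset.ne_of_mem_erase hi), expMeasure_one_Ioi]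
      have := hp i
      positivity
    rw [Finset.prod_congr rfl h4, ← ENNReal.ofReal_prod_of_nonneg fun _ _ => (Real.exp_pos _).le,
      ← Real.exp_sum]
    simp only [if_true, measure_univ, one_mul]
    congr 2
    rw [Finset.sum_neg_distrib, ← Finset.sum_mul, ← Finset.sum_div]
    have h5 := Finset.add_sum_erase Finset.univ p (Finset.mem_univ y)
    rw [hp1] at h5
    rw [← h5]
    ring
  simp only [h2]
  rw [mul_comm (G t), ← mul_assoc, ← mul_assoc, ← ENNReal.ofReal_mul (by positivity),
    ← ENNReal.ofReal_mul hy.le]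
  congr 2
  rw [one_mul, one_mul, ← Real.exp_add, ← mul_assoc, mul_inv_cancel₀ hy.ne', one_mul]
  congr 1
  field_simp
  ring

theorem clocks_wins {p : ι → ℝ} (hp : ∀ i, 0 ≤ p i) (hp1 : ∑ i, p i = 1) {y : ι}
    (hy : 0 < p y) : clocks ι (wins p y) = ENNReal.ofReal (p y) := by
  have := isProbabilityMeasure_expMeasure (inv_pos.2 hy)
  simpa using lintegral_wins hp hp1 hy (fun _ => 1) measurable_const

/-- No analysis of ties is needed: the winning events are disjoint and their probabilities `p y`
already add up to one. -/
theorem ae_mem_wins {p : ι → ℝ} (hp : ∀ i, 0 ≤ p i) (hp1 : ∑ i, p i = 1) :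
    ∀ᵐ e ∂(clocks ι), ∃ y, 0 < p y ∧ e ∈ wins p y := by
  classical
  set s : Finset ι := Finset.univ.filter fun y => 0 < p y with hs
  have hm : MeasurableSet (⋃ y ∈ s, wins p y) :=
    Finset.measurableSet_biUnion _ fun y _ => measurableSet_wins p y
  have h1 : clocks ι (⋃ y ∈ s, wins p y) = 1 := by
    rw [measure_biUnion_finset (fun y _ y' _ hne => Set.disjoint_left.2 fun e h h' =>
      hne (wins_inj h h')) fun y _ => measurableSet_wins p y,
      Finset.sum_congr rfl fun y hy => clocks_wins hp hp1 (Finset.mem_filter.1 hy).2,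
      ← ENNReal.ofReal_sum_of_nonneg fun y _ => hp y]
    have : ∑ y ∈ s, p y = ∑ y, p y := by
      refine Finset.sum_subset (Finset.subset_univ _) fun y _ hy => ?_
      simp only [hs, Finset.mem_filter, Finset.mem_univ, true_and, not_lt] at hy
      exact le_antisymm hy (hp y)
    rw [this, hp1, ENNReal.ofReal_one]
  filter_upwards [(mem_ae_iff_prob_eq_one hm).2 h1] with e he
  simpa [hs] using he

theorem lintegral_id_expMeasure {r : ℝ} (hr : 0 < r) :
    ∫⁻ t, ENNReal.ofReal t ∂(expMeasure r) = ENNReal.ofReal r⁻¹ := by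
  -- The mean of an exponential law is read off from the normalization of the Gamma density of shape
  -- two, `r² t exp (-r t)`.
  have h := lintegral_gammaPDF_eq_one (a := 2) (r := r) two_pos hr
  rw [lintegral_expMeasure _ ENNReal.measurable_ofReal, ← mul_one (ENNReal.ofReal r⁻¹), ← h,
    ← lintegral_const_mul' _ _ ENNReal.ofReal_ne_top, ← lintegral_indicator measurableSet_Ioi]
  refine lintegral_congr fun t => ?_
  rcases lt_trichotomy 0 t with ht | ht | ht
  · rw [Set.indicator_of_mem (Set.mem_Ioi.2 ht), gammaPDF_of_nonneg ht.le,
      ← ENNReal.ofReal_mul (by positivity), ← ENNReal.ofReal_mul (by positivity)]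
    congr 1
    have : Real.Gamma 2 = 1 := Real.Gamma_two
    rw [this]
    norm_num
    field_simp
  · rw [← ht, Set.indicator_of_notMem (by simp), gammaPDF_of_nonneg le_rfl]
    norm_num
  · rw [Set.indicator_of_notMem (by simpa using ht.le), gammaPDF_of_neg ht, mul_zero]

theorem integrable_clocks_eval (y : ι) : Integrable (fun e : ι → ℝ => e y) (clocks ι) := by
  have h0 : 0 ≤ᵐ[clocks ι] fun e => e y := by
    filter_upwards [ae_clocks_pos (ι := ι)] with e he using (he y).le
  refine ⟨(measurable_pi_apply y).aestronglyMeasurable, ?_⟩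
  rw [hasFiniteIntegral_iff_ofReal h0, lintegral_clocks_eval y _ ENNReal.measurable_ofReal,
    lintegral_id_expMeasure one_pos]
  exact ENNReal.ofReal_lt_top

theorem setIntegral_wins {p : ι → ℝ} (hp : ∀ i, 0 ≤ p i) (hp1 : ∑ i, p i = 1) {y : ι}
    (hy : 0 < p y) : ∫ e in wins p y, e y ∂(clocks ι) = p y ^ 2 := by
  have h0 : 0 ≤ᵐ[(clocks ι).restrict (wins p y)] fun e => e y := by
    filter_upwards [ae_restrict_of_ae (ae_clocks_pos (ι := ι))] with e he using (he y).le
  rw [integral_eq_lintegral_of_nonneg_ae h0 (measurable_pi_apply y).aestronglyMeasurable,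
    lintegral_wins hp hp1 hy _ ENNReal.measurable_ofReal, lintegral_id_expMeasure (inv_pos.2 hy),
    inv_inv, ← ENNReal.ofReal_mul hy.le, ENNReal.toReal_ofReal (by positivity), sq]

/-- A probability density on the half-line with polynomial decay. -/
noncomputable def paretoWeight (δ t : ℝ) : ℝ := δ * (1 + t) ^ (-(1 + δ))

theorem measurable_paretoWeight (δ : ℝ) : Measurable (paretoWeight δ) := by
  unfold paretoWeight; fun_prop

theorem paretoWeight_pos {δ t : ℝ} (hδ : 0 < δ) (ht : 0 ≤ t) : 0 < paretoWeight δ t :=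
  mul_pos hδ (Real.rpow_pos_of_pos (by linarith) _)

theorem neg_log_paretoWeight {δ t : ℝ} (hδ : 0 < δ) (ht : 0 ≤ t) :
    -Real.log (paretoWeight δ t) = -Real.log δ + (1 + δ) * Real.log (1 + t) := by
  have h : 0 < 1 + t := by linarith
  rw [paretoWeight, Real.log_mul hδ.ne' (Real.rpow_pos_of_pos h _).ne', Real.log_rpow h]
  ring

/-- Bounding the clock density `exp (-t)` by one leaves the integral of a probability density
rescaled by `m`. -/
theorem lintegral_paretoWeight_le {δ m : ℝ} (hδ : 0 < δ) (hm : 0 < m) (y : ι) :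
    ∫⁻ e, ENNReal.ofReal (paretoWeight δ (e y / m)) ∂(clocks ι) ≤ ENNReal.ofReal m := by
  have hmeas : Measurable fun t : ℝ => ENNReal.ofReal (paretoWeight δ (t / m)) :=
    ((measurable_paretoWeight δ).comp (by fun_prop)).ennreal_ofReal
  have hpos : ∀ t : ℝ, t ∈ Set.Ici (0 : ℝ) → 0 < 1 + t / m := fun t ht => by
    have : 0 ≤ t / m := div_nonneg ht hm.le
    linarith
  have hderiv : ∀ t ∈ Set.Ici (0 : ℝ),
      HasDerivAt (fun t => -(m * (1 + t / m) ^ (-δ))) (paretoWeight δ (t / m)) t := by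
    intro t ht
    have h1 : HasDerivAt (fun t : ℝ => 1 + t / m) (1 / m) t :=
      ((hasDerivAt_id t).div_const m).const_add 1
    convert! ((h1.rpow_const (p := -δ) (Or.inl (hpos t ht).ne')).const_mul m).neg using 1
    rw [paretoWeight, show -(1 + δ) = -δ - 1 by ring]
    field_simp
  have hnn : ∀ t ∈ Set.Ioi (0 : ℝ), 0 ≤ paretoWeight δ (t / m) := fun t ht =>
    (paretoWeight_pos hδ (div_nonneg (le_of_lt ht) hm.le)).le
  have hlim : Filter.Tendsto (fun t : ℝ => -(m * (1 + t / m) ^ (-δ))) Filter.atTop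
      (nhds (-(m * 0))) := by
    refine (Filter.Tendsto.const_mul m ?_).neg
    refine (tendsto_rpow_neg_atTop hδ).comp ?_
    exact Filter.tendsto_atTop_add_const_left _ _ (Filter.tendsto_id.atTop_div_const hm)
  have hint := integrableOn_Ioi_deriv_of_nonneg' (fun t ht => hderiv t ht) hnn hlim
  have hval := integral_Ioi_of_hasDerivAt_of_nonneg' (fun t ht => hderiv t ht) hnn hlim
  rw [lintegral_clocks_eval y (fun t => ENNReal.ofReal (paretoWeight δ (t / m))) hmeas,
    lintegral_expMeasure _ hmeas]
  calc ∫⁻ t in Set.Ioi 0, ENNReal.ofReal (1 * Real.exp (-(1 * t))) *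
        ENNReal.ofReal (paretoWeight δ (t / m))
      ≤ ∫⁻ t in Set.Ioi 0, ENNReal.ofReal (paretoWeight δ (t / m)) := by
        refine setLIntegral_mono hmeas fun t ht => ?_
        have : (0 : ℝ) < t := ht
        refine mul_le_of_le_one_left' (ENNReal.ofReal_le_one.2 ?_)
        rw [one_mul, Real.exp_le_one_iff]
        linarith
    _ = ENNReal.ofReal (∫ t in Set.Ioi 0, paretoWeight δ (t / m)) :=
        (ofReal_integral_eq_lintegral_ofReal hint
          ((ae_restrict_iff' measurableSet_Ioi).2 (Filter.Eventually.of_forall hnn))).symm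
    _ = ENNReal.ofReal m := by
        rw [hval]
        simp

theorem integrable_paretoWeight {δ m : ℝ} (hδ : 0 < δ) (hm : 0 < m) (y : ι) :
    Integrable (fun e => paretoWeight δ (e y / m)) (clocks ι) ∧
      ∫ e, paretoWeight δ (e y / m) ∂(clocks ι) ≤ m := by
  have hmeas : AEStronglyMeasurable (fun e : ι → ℝ => paretoWeight δ (e y / m)) (clocks ι) :=
    ((measurable_paretoWeight δ).comp (by fun_prop)).aestronglyMeasurable
  have h0 : 0 ≤ᵐ[clocks ι] fun e => paretoWeight δ (e y / m) := by
    filter_upwards [ae_clocks_pos (ι := ι)] with e he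
    exact (paretoWeight_pos hδ (div_nonneg (he y).le hm.le)).le
  have hle := lintegral_paretoWeight_le hδ hm y
  refine ⟨⟨hmeas, ?_⟩, ?_⟩
  · rw [hasFiniteIntegral_iff_ofReal h0]
    exact hle.trans_lt ENNReal.ofReal_lt_top
  · rw [integral_eq_lintegral_of_nonneg_ae h0 hmeas]
    exact ENNReal.toReal_le_of_le_ofReal hm.le hle

end Race

/-! ### Entropy bound for the random function selected by the race. -/

section FunctionalRepresentation

open MeasureTheory

theorem negMulLog_le {a b : ℝ} (ha : 0 ≤ a) (hb : 0 ≤ b) (hab : 0 < a → 0 < b) :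
    Real.negMulLog a ≤ a * -Real.log b + (b - a) := by
  rcases ha.eq_or_lt with rfl | ha
  · simpa using hb
  · have hb := hab ha
    have h := Real.log_le_sub_one_of_pos (div_pos hb ha)
    rw [Real.log_div hb.ne' ha.ne'] at h
    have h2 := mul_le_mul_of_nonneg_left h ha.le
    rw [mul_sub a (b / a), mul_div_cancel₀ _ ha.ne'] at h2
    rw [Real.negMulLog]
    linarith

/-- Gibbs' inequality against a nonnegative weight that need not be normalized. -/
theorem sum_negMulLog_le {ι : Type*} [Fintype ι] {a b : ι → ℝ} (ha : ∀ i, 0 ≤ a i)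
    (ha1 : ∑ i, a i = 1) (hb : ∀ i, 0 ≤ b i) (hab : ∀ i, 0 < a i → 0 < b i) :
    ∑ i, Real.negMulLog (a i) ≤ ∑ i, a i * -Real.log (b i) + (∑ i, b i - 1) := by
  rw [← ha1, ← Finset.sum_sub_distrib, ← Finset.sum_add_distrib]
  exact Finset.sum_le_sum fun i _ => negMulLog_le (ha i) (hb i) (hab i)

/-- The tangent at `r` to a concave function. With `r` the conditional mean of `t`, the linear term
integrates to zero, so this plays the role of Jensen's inequality. -/
theorem log_one_add_le {r t : ℝ} (hr : 0 ≤ r) (ht : 0 ≤ t) :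
    Real.log (1 + t) ≤ Real.log (1 + r) + (t - r) / (1 + r) := by
  have h1 : 0 < 1 + r := by linarith
  have h2 : 0 < 1 + t := by linarith
  have h := Real.log_le_sub_one_of_pos (div_pos h2 h1)
  rw [Real.log_div h2.ne' h1.ne'] at h
  have : (1 + t) / (1 + r) - 1 = (t - r) / (1 + r) := by field_simp; ring
  linarith

/-- This is `log x ≤ x - 1` at `x = (1 + c/m) / (2c/m)`. The error `(m - c) / 2` is chosen to cancel
when summed over two probability vectors. -/
theorem mul_log_one_add_div_le {c m : ℝ} (hc : 0 ≤ c) (hm : 0 < m) :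
    c * Real.log (1 + c / m) ≤ c * Real.log (c / m) + c * Real.log 2 + (m - c) / 2 := by
  rcases hc.eq_or_lt with rfl | hc
  · simp only [zero_mul, zero_add, sub_zero]
    positivity
  · have h := Real.log_le_sub_one_of_pos (x := (1 + c / m) / (2 * (c / m))) (by positivity)
    rw [Real.log_div (by positivity) (by positivity), Real.log_mul two_ne_zero (by positivity)] at h
    have h2 := mul_le_mul_of_nonneg_left h hc.le
    have h3 : c * ((1 + c / m) / (2 * (c / m)) - 1) = (m - c) / 2 := by field_simp; ring
    linarith

variable {𝒮 𝒳 : Type*} [Fintype 𝒮] [Fintype 𝒳]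

theorem sum_mul_log_one_add_le {π : 𝒮 → ℝ} {p : 𝒮 → 𝒳 → ℝ} (hπ : ∀ s, 0 ≤ π s)
    (hπ1 : ∑ s, π s = 1) (hp : ∀ s y, 0 ≤ p s y) (hp1 : ∀ s, ∑ y, p s y = 1) {m : 𝒳 → ℝ}
    (hm : ∀ y, m y = ∑ s, π s * p s y) :
    ∑ s, ∑ y, π s * p s y * Real.log (1 + p s y / m y) ≤
      ∑ s, ∑ y, π s * p s y * Real.log (p s y / m y) + Real.log 2 := by
  have hle : ∀ s y, π s * p s y ≤ m y := fun s y => by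
    rw [hm]
    exact Finset.single_le_sum (f := fun s => π s * p s y)
      (fun s _ => mul_nonneg (hπ s) (hp s y)) (Finset.mem_univ s)
  have hm0 : ∀ y, 0 ≤ m y := fun y => by
    rw [hm]; exact Finset.sum_nonneg fun s _ => mul_nonneg (hπ s) (hp s y)
  have hm1 : ∑ y, m y = 1 := by
    simp_rw [hm]
    rw [Finset.sum_comm]
    simp_rw [← Finset.mul_sum, hp1, mul_one, hπ1]
  have key : ∀ s y, π s * p s y * Real.log (1 + p s y / m y) ≤
      π s * p s y * Real.log (p s y / m y) + π s * p s y * Real.log 2 +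
        π s * ((m y - p s y) / 2) := by
    intro s y
    rcases (hm0 y).eq_or_lt with h0 | h0
    · have h1 : π s * p s y = 0 :=
        le_antisymm ((hle s y).trans h0.ge) (mul_nonneg (hπ s) (hp s y))
      have : π s * ((m y - p s y) / 2) = 0 := by rw [← h0]; linarith
      simp [h1, this]
    · have := mul_le_mul_of_nonneg_left (mul_log_one_add_div_le (hp s y) h0) (hπ s)
      linarith
  refine (Finset.sum_le_sum fun s _ => Finset.sum_le_sum fun y _ => key s y).trans_eq ?_
  simp_rw [Finset.sum_add_distrib, ← Finset.mul_sum, ← Finset.sum_mul, ← Finset.mul_sum,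
    ← Finset.sum_div, Finset.sum_sub_distrib, hp1, hm1, mul_one, hπ1]
  simp

/-- A family of conditional laws `p s` is realized by one random function `z`, of law `R`, whose
value at a random argument of law `π` has small conditional entropy given `z`. -/
theorem exists_random_function {π : 𝒮 → ℝ} {p : 𝒮 → 𝒳 → ℝ} (hπ : ∀ s, 0 ≤ π s)
    (hπ1 : ∑ s, π s = 1) (hp : ∀ s y, 0 ≤ p s y) (hp1 : ∀ s, ∑ y, p s y = 1) {m : 𝒳 → ℝ}
    (hm : ∀ y, m y = ∑ s, π s * p s y) {δ : ℝ} (hδ : 0 < δ) [DecidableEq 𝒮] [DecidableEq 𝒳] :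
    ∃ R : (𝒮 → 𝒳) → ℝ, (∀ z, 0 ≤ R z) ∧ ∑ z, R z = 1 ∧
      (∀ s y, ∑ z, (if z s = y then R z else 0) = p s y) ∧
      ∑ z, R z * ∑ y, Real.negMulLog (∑ s, if z s = y then π s else 0) ≤
        -Real.log δ +
          (1 + δ) * (∑ s, ∑ y, π s * p s y * Real.log (p s y / m y) + Real.log 2) := by
  classical
  have hle : ∀ s y, π s * p s y ≤ m y := fun s y => by
    rw [hm]
    exact Finset.single_le_sum (f := fun s => π s * p s y)
      (fun s _ => mul_nonneg (hπ s) (hp s y)) (Finset.mem_univ s)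
  have hm0 : ∀ y, 0 ≤ m y := fun y => by
    rw [hm]; exact Finset.sum_nonneg fun s _ => mul_nonneg (hπ s) (hp s y)
  have hm1 : ∑ y, m y = 1 := by
    simp_rw [hm]
    rw [Finset.sum_comm]
    simp_rw [← Finset.mul_sum, hp1, mul_one, hπ1]
  -- All races, one for each `s`, are run with the same clocks; `D z` is the event that their
  -- winners form the function `z`, and its probability will be `R z`.
  set D : (𝒮 → 𝒳) → Set (𝒳 → ℝ) := fun z => {e | ∀ s, e ∈ wins (p s) (z s)} with hD
  have hDm : ∀ z, MeasurableSet (D z) := fun z => by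
    have : D z = ⋂ s, wins (p s) (z s) := by ext; simp [hD]
    rw [this]
    exact MeasurableSet.iInter fun s => measurableSet_wins _ _
  -- almost every clock configuration selects exactly one function
  have hsel : ∀ᵐ e ∂(clocks 𝒳), ∃ z₀ : 𝒮 → 𝒳, (∀ s, 0 < p s (z₀ s)) ∧
      (∀ s y, e ∈ wins (p s) y ↔ z₀ s = y) ∧ ∀ z, e ∈ D z ↔ z₀ = z := by
    have h : ∀ᵐ e ∂(clocks 𝒳), ∀ s, ∃ y, 0 < p s y ∧ e ∈ wins (p s) y :=
      ae_all_iff.2 fun s => ae_mem_wins (hp s) (hp1 s)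
    filter_upwards [h] with e he
    choose z₀ hz₀ hw using he
    have hiff : ∀ s y, e ∈ wins (p s) y ↔ z₀ s = y := fun s y =>
      ⟨fun h => wins_inj (hw s) h, fun h => h ▸ hw s⟩
    refine ⟨z₀, hz₀, hiff, fun z => ?_⟩
    rw [funext_iff]
    exact forall_congr' fun s => hiff s (z s)
  have hwint : ∀ s y, ∫ e, (wins (p s) y).indicator (fun _ => (1 : ℝ)) e ∂(clocks 𝒳) =
      if 0 < p s y then p s y else 0 := by
    intro s y
    rw [integral_indicator_const _ (measurableSet_wins _ _), smul_eq_mul, mul_one, measureReal_def]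
    split_ifs with h
    · rw [clocks_wins (hp s) (hp1 s) h, ENNReal.toReal_ofReal h.le]
    · have : clocks 𝒳 (wins (p s) y) = 0 := by
        rw [measure_eq_zero_iff_ae_notMem]
        filter_upwards [hsel] with e ⟨z₀, hz₀, hw, _⟩ hmem
        exact h ((hw s y).1 hmem ▸ hz₀ s)
      rw [this, ENNReal.toReal_zero]
  have hDi : ∀ z, Integrable ((D z).indicator fun _ => (1 : ℝ)) (clocks 𝒳) := fun z =>
    (integrable_const 1).indicator (hDm z)
  have hR : ∀ F : (𝒮 → 𝒳) → ℝ, ∑ z, (clocks 𝒳).real (D z) * F z =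
      ∫ e, ∑ z, (D z).indicator (fun _ => (1 : ℝ)) e * F z ∂(clocks 𝒳) := by
    intro F
    rw [integral_finsetSum _ fun z _ => (hDi z).mul_const _]
    refine Finset.sum_congr rfl fun z _ => ?_
    rw [integral_mul_const, integral_indicator_const _ (hDm z), smul_eq_mul, mul_one]
  have hcol : ∀ (e : 𝒳 → ℝ) (z₀ : 𝒮 → 𝒳), (∀ z, e ∈ D z ↔ z₀ = z) → ∀ F : (𝒮 → 𝒳) → ℝ,
      ∑ z, (D z).indicator (fun _ => (1 : ℝ)) e * F z = F z₀ := by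
    intro e z₀ h F
    simp [Set.indicator_apply, h]
  refine ⟨fun z => (clocks 𝒳).real (D z), fun z => measureReal_nonneg, ?_, fun s y => ?_, ?_⟩
  · have := hR fun _ => 1
    simp only [mul_one] at this
    rw [this, integral_congr_ae (g := fun _ => (1 : ℝ)) ?_]
    · simp
    · filter_upwards [hsel] with e ⟨z₀, _, _, hz⟩
      simpa using hcol e z₀ hz fun _ => 1
  · have := hR fun z => if z s = y then 1 else 0
    simp only [mul_ite, mul_one, mul_zero] at this
    rw [this, integral_congr_ae (g := (wins (p s) y).indicator fun _ => (1 : ℝ)) ?_, hwint]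
    · split_ifs with h
      · rfl
      · exact le_antisymm (hp s y) (not_lt.1 h)
    · filter_upwards [hsel] with e ⟨z₀, _, hw, hz⟩
      have := hcol e z₀ hz fun z => if z s = y then 1 else 0
      simp only [mul_ite, mul_one, mul_zero] at this
      rw [this, Set.indicator_apply]
      simp [hw]
  · rw [hR]
    set r : 𝒮 → 𝒳 → ℝ := fun s y => p s y / m y with hr
    have hr0 : ∀ s y, 0 ≤ r s y := fun s y => div_nonneg (hp s y) (hm0 y)
    -- Slope and intercept of the affine majorant, in the winning clock, of minus the logarithm of
    -- the Pareto weight: the tangent is taken at `e y / m y = r s y`.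
    set b : 𝒮 → 𝒳 → ℝ := fun s y => (1 + δ) / ((1 + r s y) * m y) with hb
    set a : 𝒮 → 𝒳 → ℝ := fun s y =>
      -Real.log δ + (1 + δ) * (Real.log (1 + r s y) - r s y / (1 + r s y)) with ha
    -- Letters with `m y = 0` get weight zero, as rescaling by `m y` is meaningless there; Gibbs'
    -- inequality tolerates this because such letters have no mass under `z₀`.
    set q : 𝒳 → ℝ → ℝ := fun y t => if 0 < m y then paretoWeight δ (t / m y) else 0 with hq
    set B : (𝒳 → ℝ) → ℝ := fun e =>
      ∑ s, ∑ y, π s * (a s y * (wins (p s) y).indicator (fun _ => (1 : ℝ)) e +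
        b s y * (wins (p s) y).indicator (fun e => e y) e) + (∑ y, q y (e y) - 1) with hB
    have hqi : ∀ y, Integrable (fun e : 𝒳 → ℝ => q y (e y)) (clocks 𝒳) ∧
        ∫ e : 𝒳 → ℝ, q y (e y) ∂(clocks 𝒳) ≤ m y := by
      intro y
      by_cases h : 0 < m y
      · simpa [hq, h] using integrable_paretoWeight hδ h y
      · simpa [hq, h] using hm0 y
    have hai : ∀ s y, Integrable (fun e : 𝒳 → ℝ =>
        a s y * (wins (p s) y).indicator (fun _ => (1 : ℝ)) e) (clocks 𝒳) := fun s y =>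
      ((integrable_const 1).indicator (measurableSet_wins _ _)).const_mul _
    have hbi : ∀ s y, Integrable (fun e : 𝒳 → ℝ =>
        b s y * (wins (p s) y).indicator (fun e => e y) e) (clocks 𝒳) := fun s y =>
      ((integrable_clocks_eval y).indicator (measurableSet_wins _ _)).const_mul _
    have habi : ∀ s y, Integrable (fun e : 𝒳 → ℝ =>
        π s * (a s y * (wins (p s) y).indicator (fun _ => (1 : ℝ)) e +
        b s y * (wins (p s) y).indicator (fun e => e y) e)) (clocks 𝒳) := fun s y =>
      ((hai s y).add (hbi s y)).const_mul _
    have hsi : Integrable (fun e : 𝒳 → ℝ => ∑ s, ∑ y, π s *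
        (a s y * (wins (p s) y).indicator (fun _ => (1 : ℝ)) e +
        b s y * (wins (p s) y).indicator (fun e => e y) e)) (clocks 𝒳) :=
      integrable_finsetSum _ fun s _ => integrable_finsetSum _ fun y _ => habi s y
    have hqsi : Integrable (fun e : 𝒳 → ℝ => ∑ y, q y (e y)) (clocks 𝒳) :=
      integrable_finsetSum _ fun y _ => (hqi y).1
    have hq1i : Integrable (fun e : 𝒳 → ℝ => ∑ y, q y (e y) - 1) (clocks 𝒳) :=
      hqsi.sub (integrable_const 1)
    have hBi : Integrable B (clocks 𝒳) := hsi.add hq1i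
    -- Pointwise in the clocks: Gibbs' inequality for the law of `z₀(S)`, followed by the tangent
    -- bound at each winner.
    have hpt : ∀ᵐ e ∂(clocks 𝒳), ∑ z, (D z).indicator (fun _ => (1 : ℝ)) e *
        ∑ y, Real.negMulLog (∑ s, if z s = y then π s else 0) ≤ B e := by
      filter_upwards [hsel, ae_clocks_pos (ι := 𝒳)] with e ⟨z₀, hz₀, hw, hz⟩ he
      rw [hcol e z₀ hz fun z => ∑ y, Real.negMulLog (∑ s, if z s = y then π s else 0)]
      have hq0 : ∀ y, 0 ≤ q y (e y) := fun y => by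
        simp only [hq]
        split_ifs with h
        · exact (paretoWeight_pos hδ (div_nonneg (he y).le h.le)).le
        · exact le_rfl
      have hmpos : ∀ s, 0 < π s → 0 < m (z₀ s) := fun s h =>
        (mul_pos h (hz₀ s)).trans_le (hle s _)
      refine (sum_negMulLog_le (b := fun y => q y (e y)) ?_ ?_ hq0 ?_).trans ?_
      · exact fun y => Finset.sum_nonneg fun s _ => by split_ifs <;> simp [hπ]
      · rw [Finset.sum_comm]
        simpa using hπ1
      · intro y hy
        obtain ⟨s, -, hs⟩ := Finset.exists_lt_of_sum_lt
          (f := fun _ => (0 : ℝ)) (g := fun s => if z₀ s = y then π s else 0) (s := Finset.univ)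
          (by simpa using hy)
        by_cases h : z₀ s = y
        · simp only [h, if_true] at hs
          have := hmpos s hs
          rw [h] at this
          simp only [hq, this, if_true]
          exact paretoWeight_pos hδ (div_nonneg (he y).le this.le)
        · simp [h] at hs
      · simp only [hB]
        refine add_le_add ?_ le_rfl
        have h1 : ∀ y, (∑ s, if z₀ s = y then π s else 0) * -Real.log (q y (e y)) =
            ∑ s, if z₀ s = y then π s * -Real.log (q y (e y)) else 0 := fun y => by
          rw [Finset.sum_mul]
          exact Finset.sum_congr rfl fun s _ => by split_ifs <;> simp
        simp_rw [h1]
        rw [Finset.sum_comm]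
        refine Finset.sum_le_sum fun s _ => ?_
        have h2 : ∑ y, π s * (a s y * (wins (p s) y).indicator (fun _ => (1 : ℝ)) e +
            b s y * (wins (p s) y).indicator (fun e => e y) e) =
            π s * (a s (z₀ s) + b s (z₀ s) * e (z₀ s)) := by
          rw [Finset.sum_eq_single (z₀ s)]
          · simp [hw]
          · intro y _ hy
            simp [hw, Ne.symm hy]
          · simp
        rw [h2, Finset.sum_ite_eq, if_pos (Finset.mem_univ _)]
        rcases (hπ s).eq_or_lt with h0 | h0
        · simp [← h0]
        · refine mul_le_mul_of_nonneg_left ?_ h0.le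
          have hmp := hmpos s h0
          have ht : 0 ≤ e (z₀ s) / m (z₀ s) := div_nonneg (he _).le hmp.le
          simp only [hq, hmp, if_true]
          rw [neg_log_paretoWeight hδ ht]
          have h3 := mul_le_mul_of_nonneg_left (log_one_add_le (hr0 s (z₀ s)) ht)
            (by linarith : 0 ≤ 1 + δ)
          have h4 : 0 < 1 + r s (z₀ s) := by linarith [hr0 s (z₀ s)]
          have h5 : b s (z₀ s) * e (z₀ s) =
              (1 + δ) * (e (z₀ s) / m (z₀ s) / (1 + r s (z₀ s))) := by
            simp only [hb]
            field_simp
          rw [h5]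
          simp only [ha]
          rw [sub_div] at h3
          linarith
    refine (integral_mono_ae (integrable_finsetSum _ fun z _ => (hDi z).mul_const _) hBi hpt).trans
      ?_
    have hBint : ∫ e, B e ∂(clocks 𝒳) = ∑ s, ∑ y, π s *
        (a s y * (∫ e, (wins (p s) y).indicator (fun _ => (1 : ℝ)) e ∂(clocks 𝒳)) +
        b s y * ∫ e, (wins (p s) y).indicator (fun e => e y) e ∂(clocks 𝒳)) +
        (∑ y, ∫ e : 𝒳 → ℝ, q y (e y) ∂(clocks 𝒳) - 1) := by
      simp only [hB]
      rw [integral_add hsi hq1i, integral_sub hqsi (integrable_const 1),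
        integral_finsetSum _ fun y _ => (hqi y).1,
        integral_finsetSum _ fun s _ => integrable_finsetSum _ fun y _ => habi s y]
      congr 1
      · refine Finset.sum_congr rfl fun s _ => ?_
        rw [integral_finsetSum _ fun y _ => habi s y]
        refine Finset.sum_congr rfl fun y _ => ?_
        rw [integral_const_mul, integral_add (hai s y) (hbi s y), integral_const_mul,
          integral_const_mul]
      · simp
    rw [hBint]
    have h6 : ∑ y, ∫ e : 𝒳 → ℝ, q y (e y) ∂(clocks 𝒳) ≤ 1 :=
      (Finset.sum_le_sum fun y _ => (hqi y).2).trans_eq hm1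
    -- The conditional mean of the winning clock is `p s y`, so the linear term of `b` cancels the
    -- correction `r / (1 + r)` in `a`.
    have h7 : ∀ s y, π s *
        (a s y * (∫ e, (wins (p s) y).indicator (fun _ => (1 : ℝ)) e ∂(clocks 𝒳)) +
        b s y * ∫ e, (wins (p s) y).indicator (fun e => e y) e ∂(clocks 𝒳)) =
        π s * p s y * -Real.log δ +
          (1 + δ) * (π s * p s y * Real.log (1 + p s y / m y)) := by
      intro s y
      rcases (hp s y).eq_or_lt with h0 | h0
      · have hnull : clocks 𝒳 (wins (p s) y) = 0 := by
          have := hwint s y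
          rw [integral_indicator_const _ (measurableSet_wins _ _), smul_eq_mul, mul_one,
            if_neg h0.not_lt, measureReal_eq_zero_iff] at this
          exact this
        rw [hwint, if_neg h0.not_lt, integral_indicator (measurableSet_wins _ _),
          setIntegral_measure_zero _ hnull, ← h0]
        simp
      · rw [hwint, if_pos h0, integral_indicator (measurableSet_wins _ _),
          setIntegral_wins (hp s) (hp1 s) h0]
        rcases (hπ s).eq_or_lt with hs | hs
        · simp [← hs]
        · have hmp : 0 < m y := (mul_pos hs h0).trans_le (hle s y)
          have h8 : b s y * p s y ^ 2 = (1 + δ) * (p s y * (r s y / (1 + r s y))) := by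
            simp only [hb, hr]
            field_simp
          rw [h8]
          simp only [ha, hr]
          ring
    simp_rw [h7, Finset.sum_add_distrib, ← Finset.mul_sum, ← Finset.sum_mul, ← Finset.mul_sum, hp1,
      mul_one, hπ1, one_mul]
    have h9 := mul_le_mul_of_nonneg_left (sum_mul_log_one_add_le hπ hπ1 hp hp1 hm)
      (by linarith : 0 ≤ 1 + δ)
    linarith

end FunctionalRepresentation

/-! ### Mutual information and entropy of discrete variables. -/

section Discrete

variable {Ω α β γ : Type*}

/-- The probability `P(A = a)` as a real number. -/
noncomputable def prob (P : PMF Ω) (A : Ω → α) (a : α) : ℝ := (P.map A a).toReal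

/-- The entropy `H(A)`, in bits. -/
noncomputable def entropy (P : PMF Ω) (A : Ω → α) : ℝ :=
  ∑' a, prob P A a * -Real.logb 2 (prob P A a)

theorem mutualInfo_def (P : PMF Ω) (A : Ω → α) (B : Ω → β) :
    mutualInfo P A B = ∑' ab : α × β, prob P (fun ω => (A ω, B ω)) ab *
      Real.logb 2 (prob P (fun ω => (A ω, B ω)) ab / (prob P A ab.1 * prob P B ab.2)) := rfl

theorem prob_nonneg (P : PMF Ω) (A : Ω → α) (a : α) : 0 ≤ prob P A a := ENNReal.toReal_nonneg

theorem prob_le_one (P : PMF Ω) (A : Ω → α) (a : α) : prob P A a ≤ 1 := by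
  have := ENNReal.toReal_mono ENNReal.one_ne_top ((P.map A).coe_le_one a)
  rwa [ENNReal.toReal_one] at this

theorem prob_map (P : PMF Ω) (g : Ω → γ) (A : γ → α) :
    prob (P.map g) A = prob P fun ω => A (g ω) := by
  funext a
  rw [prob, prob, PMF.map_comp]
  rfl

theorem mutualInfo_map (P : PMF Ω) (g : Ω → γ) (A : γ → α) (B : γ → β) :
    mutualInfo (P.map g) A B = mutualInfo P (fun ω => A (g ω)) fun ω => B (g ω) := by
  simp only [mutualInfo_def, prob_map]

theorem entropy_map (P : PMF Ω) (g : Ω → γ) (A : γ → α) :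
    entropy (P.map g) A = entropy P fun ω => A (g ω) := by
  simp only [entropy, prob_map]

theorem prob_comp_injective (P : PMF Ω) (A : Ω → α) {g : α → β} (hg : Function.Injective g)
    (a : α) : prob P (fun ω => g (A ω)) (g a) = prob P A a := by
  classical
  rw [prob, prob, PMF.map_apply, PMF.map_apply]
  congr 1
  refine tsum_congr fun ω => ?_
  by_cases h : a = A ω
  · simp [h]
  · rw [if_neg h, if_neg fun h' => h (hg h')]

theorem prob_eq_zero (P : PMF Ω) (A : Ω → α) {a : α} (h : ∀ ω, A ω ≠ a) : prob P A a = 0 := by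
  simp [prob, PMF.map_apply, fun ω => (h ω).symm]

theorem mutualInfo_comm (P : PMF Ω) (A : Ω → α) (B : Ω → β) :
    mutualInfo P A B = mutualInfo P B A := by
  rw [mutualInfo_def, mutualInfo_def, ← (Equiv.prodComm α β).tsum_eq]
  refine tsum_congr fun ab => ?_
  have h := prob_comp_injective P (fun ω => (A ω, B ω)) (Prod.swap_injective (α := α) (β := β)) ab
  simp only [Prod.swap_prod_mk] at h
  rw [Equiv.prodComm_apply, h, Prod.fst_swap, Prod.snd_swap, mul_comm (prob P B _)]

theorem mutualInfo_comp_injective_left (P : PMF Ω) (A : Ω → α) (B : Ω → β) {g : α → γ}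
    (hg : Function.Injective g) : mutualInfo P (fun ω => g (A ω)) B = mutualInfo P A B := by
  have hg' : Function.Injective (Prod.map g (id : β → β)) := hg.prodMap Function.injective_id
  rw [mutualInfo_def, mutualInfo_def, ← hg'.tsum_eq]
  · refine tsum_congr fun ab => ?_
    have h := prob_comp_injective P (fun ω => (A ω, B ω)) hg' ab
    simp only [Prod.map_apply, id] at h
    simp only [Prod.map, id] at h ⊢
    rw [h, prob_comp_injective P A hg]
  · rintro ⟨c, b⟩ hcb
    by_contra hne
    refine hcb ?_
    dsimp only
    rw [prob_eq_zero P (fun ω => (g (A ω), B ω)), zero_mul]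
    intro ω hω
    exact hne ⟨(A ω, B ω), hω⟩

theorem mutualInfo_comp_injective_right (P : PMF Ω) (A : Ω → α) (B : Ω → β) {g : β → γ}
    (hg : Function.Injective g) : mutualInfo P A (fun ω => g (B ω)) = mutualInfo P A B := by
  rw [mutualInfo_comm, mutualInfo_comp_injective_left P B A hg, mutualInfo_comm]

/-- Mutual information only depends on the partition induced by the first variable. -/
theorem mutualInfo_congr_left (P : PMF Ω) {A : Ω → α} {A' : Ω → γ} (B : Ω → β)
    (h : ∀ ω ω', A ω = A ω' ↔ A' ω = A' ω') : mutualInfo P A B = mutualInfo P A' B := by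
  have hval := mutualInfo_comp_injective_left P (Set.rangeFactorization A') B
    (g := Subtype.val) Subtype.val_injective
  have hA' : ∀ ω, (Set.rangeFactorization A' ω).val = A' ω := fun ω => rfl
  -- `A` factors injectively through the range of `A'`: any representative will do, since both maps
  -- induce the same partition.
  let g : Set.range A' → α := fun c => A c.2.choose
  have hgA : ∀ ω, g (Set.rangeFactorization A' ω) = A ω := fun ω =>
    (h _ _).2 (Set.rangeFactorization A' ω).2.choose_spec
  have hg : Function.Injective g := fun c c' hcc => by
    have h1 := (h _ _).1 hcc
    rw [c.2.choose_spec, c'.2.choose_spec] at h1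
    exact Subtype.ext h1
  have h2 := mutualInfo_comp_injective_left P (Set.rangeFactorization A') B hg
  simp only [hgA] at h2
  simp only [hA'] at hval
  rw [h2, hval]

theorem hasSum_toReal (L : PMF α) : HasSum (fun a => (L a).toReal) 1 := by
  have h := ENNReal.hasSum_toReal (f := L) (by rw [L.tsum_coe]; exact ENNReal.one_ne_top)
  rwa [← ENNReal.tsum_toReal_eq L.apply_ne_top, L.tsum_coe, ENNReal.toReal_one] at h

theorem hasSum_prob (P : PMF Ω) (A : Ω → α) : HasSum (prob P A) 1 := hasSum_toReal _

theorem hasSum_prob_pair_left (P : PMF Ω) (A : Ω → α) (B : Ω → β) (a : α) :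
    HasSum (fun b => prob P (fun ω => (A ω, B ω)) (a, b)) (prob P A a) := by
  classical
  set L := P.map fun ω => (A ω, B ω) with hL
  have hA : P.map A = L.map Prod.fst := by rw [hL, PMF.map_comp]; rfl
  have h1 : L.map Prod.fst a = ∑' b, L (a, b) := by
    rw [PMF.map_apply, ENNReal.tsum_prod', tsum_eq_single a]
    · simp
    · intro a' ha'
      simp [Ne.symm ha']
  have h2 : ∑' b, L (a, b) ≠ ⊤ := h1 ▸ PMF.apply_ne_top _ _
  have h := ENNReal.hasSum_toReal h2
  rw [prob, hA, h1, ENNReal.tsum_toReal_eq fun b => L.apply_ne_top (a, b)]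
  exact h

theorem prob_pair_le_left (P : PMF Ω) (A : Ω → α) (B : Ω → β) (a : α) (b : β) :
    prob P (fun ω => (A ω, B ω)) (a, b) ≤ prob P A a :=
  le_hasSum (hasSum_prob_pair_left P A B a) b fun _ _ => prob_nonneg _ _ _

theorem prob_pair_le_right (P : PMF Ω) (A : Ω → α) (B : Ω → β) (a : α) (b : β) :
    prob P (fun ω => (A ω, B ω)) (a, b) ≤ prob P B b := by
  have h := prob_comp_injective P (fun ω => (A ω, B ω)) (Prod.swap_injective (α := α) (β := β))
    (a, b)
  simp only [Prod.swap_prod_mk] at h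
  rw [← h]
  exact prob_pair_le_left P B A b a

/-- The terms are squeezed between two summable families: `log x ≥ 1 - 1/x` gives a lower one of
total zero, and `P(a,b) ≤ P(b)` an upper one of total `H(A)`. The squeeze also yields summability,
which matters because `B` may take infinitely many values. -/
theorem mutualInfo_nonneg_and_le_entropy [Fintype α] (P : PMF Ω) (A : Ω → α) (B : Ω → β) :
    0 ≤ mutualInfo P A B ∧ mutualInfo P A B ≤ entropy P A := by
  set J : α × β → ℝ := prob P (fun ω => (A ω, B ω)) with hJ
  set p := prob P A with hp
  set q := prob P B with hq
  have hln : 0 < Real.log 2 := Real.log_pos one_lt_two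
  have hJ0 : ∀ ab, 0 ≤ J ab := prob_nonneg _ _
  have hp0 : ∀ a, 0 ≤ p a := prob_nonneg _ _
  have hq0 : ∀ b, 0 ≤ q b := prob_nonneg _ _
  have hp1 : ∀ a, p a ≤ 1 := prob_le_one _ _
  have hJp : ∀ ab : α × β, J ab ≤ p ab.1 := fun ab => prob_pair_le_left P A B ab.1 ab.2
  have hJq : ∀ ab : α × β, J ab ≤ q ab.2 := fun ab => prob_pair_le_right P A B ab.1 ab.2
  have hJs : HasSum J 1 := hasSum_prob _ _
  have hlogp : ∀ a, 0 ≤ -Real.logb 2 (p a) := fun a =>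
    neg_nonneg.2 (Real.logb_nonpos one_lt_two (hp0 a) (hp1 a))
  set f : α × β → ℝ := fun ab => J ab * Real.logb 2 (J ab / (p ab.1 * q ab.2)) with hf
  set u : α × β → ℝ := fun ab => J ab * -Real.logb 2 (p ab.1) with hu
  set l : α × β → ℝ := fun ab => (J ab - p ab.1 * q ab.2) / Real.log 2 with hl
  have hpq : HasSum (fun ab : α × β => p ab.1 * q ab.2) 1 := by
    have hs : Summable fun ab : α × β => p ab.1 * q ab.2 :=
      (hasSum_prob P A).summable.mul_of_nonneg (hasSum_prob P B).summable hp0 hq0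
    have := (hasSum_prob P A).mul (hasSum_prob P B) hs
    rwa [one_mul] at this
  have hls : HasSum l 0 := by
    have := (hJs.sub hpq).div_const (Real.log 2)
    rwa [sub_self, zero_div] at this
  have hus : Summable u := by
    refine Summable.of_nonneg_of_le (fun ab => mul_nonneg (hJ0 ab) (hlogp _)) (fun ab => ?_)
      (hJs.summable.mul_right (∑ a, -Real.logb 2 (p a)))
    exact mul_le_mul_of_nonneg_left
      (Finset.single_le_sum (f := fun a => -Real.logb 2 (p a)) (fun a _ => hlogp a)
        (Finset.mem_univ _)) (hJ0 ab)
  have hfu : ∀ ab, f ab ≤ u ab := by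
    intro ab
    rcases (hJ0 ab).eq_or_lt with h | h
    · simp [hf, hu, ← h]
    · have h1 := h.trans_le (hJp ab)
      have h2 := h.trans_le (hJq ab)
      refine mul_le_mul_of_nonneg_left ?_ h.le
      rw [← Real.logb_inv]
      refine Real.logb_le_logb_of_le one_lt_two (by positivity) ?_
      rw [div_le_iff₀ (by positivity), inv_mul_cancel_left₀ h1.ne']
      exact hJq ab
  have hlf : ∀ ab, l ab ≤ f ab := by
    intro ab
    rcases (hJ0 ab).eq_or_lt with h | h
    · simp only [hf, hl, ← h, zero_mul, zero_sub]
      exact div_nonpos_of_nonpos_of_nonneg (neg_nonpos.2 (mul_nonneg (hp0 _) (hq0 _))) hln.le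
    · have h1 := h.trans_le (hJp ab)
      have h2 := h.trans_le (hJq ab)
      have h3 := Real.one_sub_inv_le_log_of_pos (x := J ab / (p ab.1 * q ab.2)) (by positivity)
      have h4 := mul_le_mul_of_nonneg_left h3 h.le
      simp only [hf, hl, Real.logb]
      rw [← mul_div_assoc]
      refine div_le_div_of_nonneg_right ?_ hln.le
      refine le_trans (le_of_eq ?_) h4
      rw [inv_div, mul_sub, mul_div_cancel₀ _ h.ne', mul_one]
  have hfs : Summable f := by
    refine Summable.of_norm_bounded (hls.summable.abs.add hus.abs) fun ab => ?_
    rw [Real.norm_eq_abs, abs_le]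
    constructor
    · linarith [neg_abs_le (l ab), abs_nonneg (u ab), hlf ab]
    · linarith [le_abs_self (u ab), abs_nonneg (l ab), hfu ab]
  have hI : mutualInfo P A B = ∑' ab, f ab := rfl
  rw [hI]
  constructor
  · rw [← hls.tsum_eq]
    exact hls.summable.tsum_le_tsum hlf hfs
  · refine (hfs.tsum_le_tsum hfu hus).trans_eq ?_
    rw [hus.tsum_prod]
    refine tsum_congr fun a => ?_
    exact ((hasSum_prob_pair_left P A B a).mul_right (-Real.logb 2 (p a))).tsum_eq

end Discrete

/-! ### Information quantities as expectations on a finite space. -/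

section Finite

variable {Ω α β γ : Type*} [Fintype Ω]

theorem prob_eq_sum (P : PMF Ω) (A : Ω → α) [DecidableEq α] (a : α) :
    prob P A a = ∑ ω, if A ω = a then (P ω).toReal else 0 := by
  rw [prob, PMF.map_apply, tsum_fintype, ENNReal.toReal_sum fun ω _ => by
    split_ifs <;> simp [P.apply_ne_top]]
  refine Finset.sum_congr rfl fun ω _ => ?_
  by_cases h : A ω = a
  · simp [h]
  · simp [h, Ne.symm h]

theorem toReal_le_prob (P : PMF Ω) (A : Ω → α) (ω : Ω) : (P ω).toReal ≤ prob P A (A ω) := by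
  classical
  rw [prob_eq_sum]
  refine le_trans (le_of_eq ?_) (Finset.single_le_sum
    (f := fun ω' => if A ω' = A ω then (P ω').toReal else 0) (fun ω' _ => ?_) (Finset.mem_univ ω))
  · simp
  · split_ifs <;> simp

theorem prob_pos (P : PMF Ω) (A : Ω → α) {ω : Ω} (h : 0 < (P ω).toReal) : 0 < prob P A (A ω) :=
  h.trans_le (toReal_le_prob P A ω)

/-- The expectation of a function of `A`. -/
theorem tsum_prob_mul (P : PMF Ω) (A : Ω → α) (F : α → ℝ) :
    ∑' a, prob P A a * F a = ∑ ω, (P ω).toReal * F (A ω) := by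
  classical
  rw [tsum_eq_sum (s := Finset.univ.image A) fun a ha => by
    rw [prob_eq_zero, zero_mul]
    intro ω hω
    exact ha (Finset.mem_image.2 ⟨ω, Finset.mem_univ _, hω⟩)]
  simp_rw [prob_eq_sum, Finset.sum_mul]
  rw [Finset.sum_comm]
  refine Finset.sum_congr rfl fun ω _ => ?_
  rw [Finset.sum_eq_single (A ω)]
  · simp
  · intro a _ ha
    simp [Ne.symm ha]
  · intro h
    exact absurd (Finset.mem_image_of_mem A (Finset.mem_univ ω)) h

theorem mutualInfo_eq_sum (P : PMF Ω) (A : Ω → α) (B : Ω → β) :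
    mutualInfo P A B = ∑ ω, (P ω).toReal *
      Real.logb 2 (prob P (fun ω => (A ω, B ω)) (A ω, B ω) / (prob P A (A ω) * prob P B (B ω))) :=
  tsum_prob_mul P (fun ω => (A ω, B ω)) _

theorem entropy_eq_sum (P : PMF Ω) (A : Ω → α) :
    entropy P A = ∑ ω, (P ω).toReal * -Real.logb 2 (prob P A (A ω)) :=
  tsum_prob_mul P A _

theorem condEntropy_eq_sum (P : PMF Ω) (A : Ω → α) (B : Ω → β) :
    condEntropy P A B = ∑ ω, (P ω).toReal *
      Real.logb 2 (prob P B (B ω) / prob P (fun ω => (A ω, B ω)) (A ω, B ω)) :=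
  tsum_prob_mul P (fun ω => (A ω, B ω))
    fun ab => Real.logb 2 (prob P B ab.2 / prob P (fun ω => (A ω, B ω)) ab)

theorem mutualInfo_add_condEntropy (P : PMF Ω) (A : Ω → α) (B : Ω → β) :
    mutualInfo P A B + condEntropy P A B = entropy P A := by
  rw [mutualInfo_eq_sum, condEntropy_eq_sum, entropy_eq_sum, ← Finset.sum_add_distrib]
  refine Finset.sum_congr rfl fun ω _ => ?_
  rcases (ENNReal.toReal_nonneg (a := P ω)).eq_or_lt with h | h
  · simp [← h]
  · have hA := prob_pos P A h
    have hB := prob_pos P B h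
    have hAB := prob_pos P (fun ω => (A ω, B ω)) h
    rw [Real.logb_div hAB.ne' (mul_pos hA hB).ne', Real.logb_mul hA.ne' hB.ne',
      Real.logb_div hB.ne' hAB.ne']
    ring

theorem entropy_const (P : PMF Ω) (c : α) : entropy P (fun _ => c) = 0 := by
  classical
  rw [entropy_eq_sum]
  refine Finset.sum_eq_zero fun ω _ => ?_
  have : prob P (fun _ => c) c = 1 := by
    rw [prob_eq_sum]
    simpa using (hasSum_toReal P).tsum_eq
  rw [this, Real.logb_one, neg_zero, mul_zero]

theorem mutualInfo_const_left (P : PMF Ω) (c : α) (B : Ω → β) :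
    mutualInfo P (fun _ => c) B = 0 := by
  have h := mutualInfo_nonneg_and_le_entropy P (fun _ => ()) B
  rw [entropy_const] at h
  rw [mutualInfo_congr_left P B (A' := fun _ => ()) (by simp)]
  exact le_antisymm h.2 h.1

end Finite

/-! ### Joint laws and disintegration. -/

section Kernels

theorem jointLaw_apply {Z 𝒰 : Type*} (P : PMF Z) (K : Z → PMF 𝒰) (z : Z) (u : 𝒰) :
    jointLaw P K (z, u) = P z * K z u := by
  classical
  rw [jointLaw, PMF.bind_apply, tsum_eq_single z]
  · rw [PMF.map_apply, tsum_eq_single u]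
    · simp
    · intro u' hu'
      simp [Ne.symm hu']
  · intro z' hz'
    rw [PMF.map_apply]
    simp [Ne.symm hz']

theorem jointLaw_map_fst {Z 𝒰 : Type*} (P : PMF Z) (K : Z → PMF 𝒰) :
    (jointLaw P K).map Prod.fst = P := by
  rw [jointLaw, PMF.map_bind]
  simp_rw [PMF.map_comp]
  have : ∀ z, (K z).map (Prod.fst ∘ fun u => (z, u)) = PMF.pure z := fun z => PMF.map_const (K z) z
  simp_rw [this]
  exact PMF.bind_pure P

theorem jointLaw_map_right {Z 𝒰 𝒱 : Type*} (P : PMF Z) (K : Z → PMF 𝒰) (g : 𝒰 → 𝒱) :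
    jointLaw P (fun z => (K z).map g) = (jointLaw P K).map fun q => (q.1, g q.2) := by
  rw [jointLaw, jointLaw, PMF.map_bind]
  simp_rw [PMF.map_comp]
  rfl

/-- Disintegration of the joint law of `(C, U)` along `C`. -/
theorem exists_jointLaw_eq_map {Ω γ 𝒰 : Type*} (T : PMF Ω) (C : Ω → γ) (U : Ω → 𝒰) :
    ∃ V : γ → PMF 𝒰, jointLaw (T.map C) V = T.map fun ω => (C ω, U ω) := by
  classical
  obtain ⟨ω₀, -⟩ := T.support_nonempty
  -- The conditional law of `U` given `C = c`; on null values of `c` an arbitrary point mass is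
  -- used.
  refine ⟨fun c => if h : ∃ ω ∈ {ω | C ω = c}, ω ∈ T.support then (T.filter _ h).map U
    else PMF.pure (U ω₀), ?_⟩
  ext ⟨c, u⟩
  rw [jointLaw_apply]
  have hc : T.map C c = ∑' ω, {ω | C ω = c}.indicator T ω := by
    rw [PMF.map_apply]
    refine tsum_congr fun ω => ?_
    by_cases h : C ω = c
    · simp [h]
    · simp [h, Ne.symm h]
  split_ifs with h
  · have h0 : T.map C c ≠ 0 := by
      obtain ⟨ω, hω, hT⟩ := h
      rw [← PMF.mem_support_iff, PMF.mem_support_map_iff]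
      exact ⟨ω, hT, hω⟩
    rw [PMF.map_apply U, PMF.map_apply (fun ω => (C ω, U ω)), ← ENNReal.tsum_mul_left]
    refine tsum_congr fun ω => ?_
    rw [PMF.filter_apply, ← hc]
    by_cases hu : u = U ω
    · by_cases hω : C ω = c
      · simp only [hu, if_true, Set.indicator_apply, Set.mem_ofPred_eq, hω]
        rw [mul_comm, mul_assoc, ENNReal.inv_mul_cancel h0 (PMF.apply_ne_top _ _), mul_one]
      · simp [hω, Ne.symm hω]
    · simp [hu]
  · have h0 : T.map C c = 0 := by
      rw [PMF.apply_eq_zero_iff, PMF.mem_support_map_iff]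
      rintro ⟨ω, hT, hω⟩
      exact h ⟨ω, hω, hT⟩
    rw [h0, zero_mul, eq_comm, PMF.apply_eq_zero_iff, PMF.mem_support_map_iff]
    rintro ⟨ω, hT, hω⟩
    exact h ⟨ω, (Prod.ext_iff.1 hω).1, hT⟩

theorem exists_pmf_toReal_eq {Ω : Type*} [Fintype Ω] {w : Ω → ℝ} (hw : ∀ ω, 0 ≤ w ω)
    (hw1 : ∑ ω, w ω = 1) : ∃ T : PMF Ω, ∀ ω, (T ω).toReal = w ω := by
  refine ⟨PMF.ofFintype (fun ω => ENNReal.ofReal (w ω)) ?_, fun ω => ?_⟩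
  · rw [← ENNReal.ofReal_sum_of_nonneg fun ω _ => hw ω, hw1, ENNReal.ofReal_one]
  · rw [PMF.ofFintype_apply, ENNReal.toReal_ofReal (hw ω)]

theorem pmf_ext_toReal {Ω : Type*} {P Q : PMF Ω} (h : ∀ ω, (P ω).toReal = (Q ω).toReal) :
    P = Q := by
  ext ω
  exact (ENNReal.toReal_eq_toReal_iff' (P.apply_ne_top _) (Q.apply_ne_top _)).1 (h ω)

end Kernels

/-! ### The mechanism for a single letter. -/

section Letter

variable {𝒮 𝒳 : Type*} [Fintype 𝒮] [Fintype 𝒳]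

/-- The strong functional representation lemma: `X = Z(S)` for a random function `Z` independent
of `S` such that `H(X | Z) ≤ I(S; X) + log (I(S; X) + 1) + 2`. -/
theorem exists_functional_representation [DecidableEq 𝒮] [DecidableEq 𝒳] (P : PMF (𝒮 × 𝒳)) :
    ∃ R : (𝒮 → 𝒳) → ℝ, (∀ z, 0 ≤ R z) ∧ ∑ z, R z = 1 ∧
      (∀ s y, prob P Prod.fst s * ∑ z, (if z s = y then R z else 0) = (P (s, y)).toReal) ∧
      ∑ z, R z * ∑ y, Real.negMulLog (∑ s, if z s = y then prob P Prod.fst s else 0) ≤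
        Real.log 2 * (mutualInfo P Prod.fst Prod.snd +
          Real.logb 2 (mutualInfo P Prod.fst Prod.snd + 1) + 2) := by
  set π := prob P Prod.fst with hπ
  set m := prob P Prod.snd with hm
  set I := mutualInfo P Prod.fst Prod.snd with hI
  have hI0 : 0 ≤ I := (mutualInfo_nonneg_and_le_entropy P _ _).1
  have hln : 0 < Real.log 2 := Real.log_pos one_lt_two
  set J : 𝒮 × 𝒳 → ℝ := fun q => (P q).toReal with hJ
  have hπs : ∀ s, π s = ∑ y, J (s, y) := by
    intro s
    rw [hπ, prob_eq_sum, Fintype.sum_prod_type, Finset.sum_eq_single s]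
    · simp [hJ]
    · intro s' _ hs'
      simp [hs']
    · simp
  have hms : ∀ y, m y = ∑ s, J (s, y) := by
    intro y
    rw [hm, prob_eq_sum, Fintype.sum_prod_type]
    simp [hJ]
  have hJ0 : ∀ q, 0 ≤ J q := fun q => ENNReal.toReal_nonneg
  have hπ0 : ∀ s, 0 ≤ π s := prob_nonneg _ _
  have hm0 : ∀ y, 0 ≤ m y := prob_nonneg _ _
  have hπ1 : ∑ s, π s = 1 := by simpa using (hasSum_prob P Prod.fst).tsum_eq
  have hm1 : ∑ y, m y = 1 := by simpa using (hasSum_prob P Prod.snd).tsum_eq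
  have hJπ : ∀ s y, J (s, y) ≤ π s := fun s y => toReal_le_prob P Prod.fst (s, y)
  -- The conditional law of `X` given `s`; for null `s` it is set to the marginal `m`, so that each
  -- row is still a probability vector.
  set p : 𝒮 → 𝒳 → ℝ := fun s y => if π s = 0 then m y else J (s, y) / π s with hp
  have hπp : ∀ s y, π s * p s y = J (s, y) := by
    intro s y
    simp only [hp]
    split_ifs with h
    · rw [h, zero_mul]
      exact le_antisymm (hJ0 _) ((hJπ s y).trans h.le)
    · rw [mul_div_cancel₀ _ h]
  have hp0 : ∀ s y, 0 ≤ p s y := by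
    intro s y
    simp only [hp]
    split_ifs with h
    · exact hm0 y
    · exact div_nonneg (hJ0 _) (hπ0 s)
  have hp1 : ∀ s, ∑ y, p s y = 1 := by
    intro s
    simp only [hp]
    split_ifs with h
    · exact hm1
    · rw [← Finset.sum_div, ← hπs, div_self h]
  -- With `δ = 1 / (I + 1)`, `I` in bits, the bound becomes `log (I + 1) + (1 + δ)(I + 1) log 2`,
  -- and `(1 + δ)(I + 1) = I + 2`.
  have hδ : 0 < 1 / (I + 1) := by positivity
  obtain ⟨R, hR0, hR1, hRp, hRH⟩ := exists_random_function hπ0 hπ1 hp0 hp1 (m := m)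
    (fun y => by simp_rw [hπp, hms]) hδ
  refine ⟨R, hR0, hR1, fun s y => by rw [hRp, hπp], hRH.trans ?_⟩
  have hIsum : ∑ s, ∑ y, π s * p s y * Real.log (p s y / m y) = Real.log 2 * I := by
    have hid : prob P (fun q => (q.1, q.2)) = J := by
      funext q
      change (P.map id q).toReal = _
      rw [PMF.map_id]
    rw [hI, mutualInfo_eq_sum, Fintype.sum_prod_type, Finset.mul_sum]
    refine Finset.sum_congr rfl fun s _ => ?_
    rw [Finset.mul_sum]
    refine Finset.sum_congr rfl fun y _ => ?_
    rw [hid, hπp]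
    change J (s, y) * _ = _ * (J (s, y) * Real.logb 2 (J (s, y) / (π s * m y)))
    rcases (hJ0 (s, y)).eq_or_lt with h | h
    · simp [← h]
    · have h1 : π s ≠ 0 := (h.trans_le (hJπ s y)).ne'
      have h2 : p s y / m y = J (s, y) / (π s * m y) := by
        simp only [hp, if_neg h1, div_div]
      rw [h2, Real.logb]
      field_simp
  rw [hIsum]
  refine le_of_eq ?_
  rw [one_div, Real.log_inv, Real.logb]
  field_simp
  ring

/-- The letterwise mechanism: `U = (Z, W)` with `Z` as in the functional representation lemma and
`W` an erased version of `S` with erasure probability `1 - a`. -/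
theorem exists_letter_kernel (P : PMF (𝒮 × 𝒳)) {a : ℝ} (ha : 0 ≤ a) (ha1 : a ≤ 1) :
    ∃ V : 𝒮 × 𝒳 → PMF ((𝒮 → 𝒳) × Option 𝒮),
      mutualInfo (jointLaw P V) (fun q => q.1.1) (fun q => q.2) = a * entropy P Prod.fst ∧
      entropy P Prod.snd ≤ mutualInfo (jointLaw P V) (fun q => q.1.2) (fun q => q.2) +
        min (entropy P Prod.fst) (mutualInfo P Prod.fst Prod.snd +
          (Real.logb 2 (mutualInfo P Prod.fst Prod.snd + 1) + 4)) := by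
  classical
  obtain ⟨R, hR0, hR1, hRP, hRH⟩ := exists_functional_representation P
  set π := prob P Prod.fst with hπ
  set m := prob P Prod.snd with hm
  have hln : 0 < Real.log 2 := Real.log_pos one_lt_two
  have hπ0 : ∀ s, 0 ≤ π s := prob_nonneg _ _
  have hπ1 : ∑ s, π s = 1 := by simpa using (hasSum_prob P Prod.fst).tsum_eq
  set e : Bool → ℝ := fun b => if b then a else 1 - a with he
  have he0 : ∀ b, 0 ≤ e b := by
    intro b; cases b <;> simp [he, ha, ha1]
  have he1 : ∑ b, e b = 1 := by simp [he]
  -- The mechanism lives on independent triples: `S`, the random function, and a coin that reveals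
  -- `S` with probability `a`. The kernel is then obtained by disintegrating along `(S, Z(S))`,
  -- whose law is `P`.
  obtain ⟨T, hT⟩ := exists_pmf_toReal_eq (Ω := 𝒮 × (𝒮 → 𝒳) × Bool)
    (w := fun ω => π ω.1 * (R ω.2.1 * e ω.2.2))
    (fun ω => mul_nonneg (hπ0 _) (mul_nonneg (hR0 _) (he0 _))) (by
      simp_rw [Fintype.sum_prod_type, ← Finset.mul_sum, he1, mul_one, hR1, mul_one, hπ1])
  set C : 𝒮 × (𝒮 → 𝒳) × Bool → 𝒮 × 𝒳 := fun ω => (ω.1, ω.2.1 ω.1) with hC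
  set U : 𝒮 × (𝒮 → 𝒳) × Bool → (𝒮 → 𝒳) × Option 𝒮 :=
    fun ω => (ω.2.1, if ω.2.2 then some ω.1 else none) with hU
  have hprob : ∀ {τ : Type _} [DecidableEq τ] (F : 𝒮 × (𝒮 → 𝒳) × Bool → τ) (c : τ),
      prob T F c = ∑ s, ∑ z, ∑ b, if F (s, z, b) = c then π s * (R z * e b) else 0 := by
    intro τ _ F c
    rw [prob_eq_sum]
    simp_rw [Fintype.sum_prod_type, hT]
  have hTC : T.map C = P := by
    refine pmf_ext_toReal fun q => ?_
    obtain ⟨s, y⟩ := q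
    change prob T C (s, y) = _
    rw [hprob, ← hRP, Finset.sum_eq_single s]
    · rw [Finset.mul_sum]
      refine Finset.sum_congr rfl fun z _ => ?_
      simp only [hC, Prod.mk.injEq, true_and]
      split_ifs
      · rw [← Finset.mul_sum, ← Finset.mul_sum, he1, mul_one]
      · simp
    · intro s' _ hs'
      simp [hC, hs']
    · simp
  obtain ⟨V, hV⟩ := exists_jointLaw_eq_map T C U
  rw [hTC] at hV
  have hS : prob T (fun ω => (C ω).1) = π := by rw [hπ, ← hTC, prob_map]
  have hX : prob T (fun ω => (C ω).2) = m := by rw [hm, ← hTC, prob_map]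
  have hUs : ∀ s z, prob T U (z, some s) = π s * (R z * a) := by
    intro s z
    rw [hprob, Finset.sum_eq_single s, Finset.sum_eq_single z]
    · simp [hU, he]
    · intro z' _ hz'
      simp [hU, hz']
    · simp
    · intro s' _ hs'
      simp [hU, hs']
    · simp
  have hUn : ∀ z, prob T U (z, none) = R z * (1 - a) := by
    intro z
    rw [hprob, Finset.sum_comm, Finset.sum_eq_single z]
    · simp [hU, he, ← Finset.sum_mul, hπ1]
    · intro z' _ hz'
      simp [hU, hz']
    · simp
  have hSUs : ∀ s z, prob T (fun ω => ((C ω).1, U ω)) (s, (z, some s)) = π s * (R z * a) := by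
    intro s z
    rw [hprob, Finset.sum_eq_single s, Finset.sum_eq_single z]
    · simp [hU, hC, he]
    · intro z' _ hz'
      simp [hU, hz']
    · simp
    · intro s' _ hs'
      simp [hC, hs']
    · simp
  have hSUn : ∀ s z, prob T (fun ω => ((C ω).1, U ω)) (s, (z, none)) = π s * (R z * (1 - a)) := by
    intro s z
    rw [hprob, Finset.sum_eq_single s, Finset.sum_eq_single z]
    · simp [hU, hC, he]
    · intro z' _ hz'
      simp [hU, hz']
    · simp
    · intro s' _ hs'
      simp [hC, hs']
    · simp
  have hXUs : ∀ s z, prob T (fun ω => ((C ω).2, U ω)) (z s, (z, some s)) = π s * (R z * a) := by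
    intro s z
    rw [hprob, Finset.sum_eq_single s, Finset.sum_eq_single z]
    · simp [hU, hC, he]
    · intro z' _ hz'
      simp [hU, hz']
    · simp
    · intro s' _ hs'
      simp [hU, hs']
    · simp
  -- `κ z` is the law of `z(S)`: the conditional law of `X` given `Z = z` when `S` is erased.
  set κ : (𝒮 → 𝒳) → 𝒳 → ℝ := fun z y => ∑ s, if z s = y then π s else 0 with hκ
  have hXUn : ∀ s z, prob T (fun ω => ((C ω).2, U ω)) (z s, (z, none)) =
      κ z (z s) * (R z * (1 - a)) := by
    intro s z
    rw [hprob, Finset.sum_comm, Finset.sum_eq_single z]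
    · simp [hU, hC, he, hκ, Finset.sum_mul, ite_mul]
    · intro z' _ hz'
      simp [hU, hz']
    · simp
  have hκπ : ∀ s z, π s ≤ κ z (z s) := by
    intro s z
    refine le_trans (le_of_eq ?_) (Finset.single_le_sum
      (f := fun s' => if z s' = z s then π s' else 0) (fun s' _ => ?_) (Finset.mem_univ s))
    · simp
    · split_ifs <;> simp [hπ0]
  have hHS : entropy P Prod.fst = ∑ s, π s * -Real.logb 2 (π s) := tsum_fintype _
  refine ⟨V, ?_, ?_⟩
  · rw [hV, mutualInfo_map, mutualInfo_eq_sum]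
    -- The information density is zero on erasure, by independence of `S` and `Z`, and `-log π(s)`
    -- when `S` is revealed.
    have hterm : ∀ ω : 𝒮 × (𝒮 → 𝒳) × Bool, (T ω).toReal * Real.logb 2
        (prob T (fun ω => ((C ω).1, U ω)) ((C ω).1, U ω) /
          (prob T (fun ω => (C ω).1) (C ω).1 * prob T U (U ω))) =
        if ω.2.2 then π ω.1 * -Real.logb 2 (π ω.1) * (R ω.2.1 * a) else 0 := by
      rintro ⟨s, z, b⟩
      rw [hS, hT]
      dsimp only [hC]
      cases b
      · have h1 : U (s, z, false) = (z, none) := by simp [hU]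
        rw [h1, hSUn, hUn]
        change π s * (R z * (1 - a)) *
          Real.logb 2 (π s * (R z * (1 - a)) / (π s * (R z * (1 - a)))) = 0
        by_cases h : π s * (R z * (1 - a)) = 0
        · rw [h, zero_mul]
        · rw [div_self h, Real.logb_one, mul_zero]
      · have h1 : U (s, z, true) = (z, some s) := by simp [hU]
        rw [h1, hSUs, hUs]
        simp only [he, if_true]
        by_cases h : π s * (R z * a) = 0
        · rcases mul_eq_zero.1 h with h | h <;> simp [h]
        · rw [mul_comm (π s) (π s * _), div_mul_eq_div_div, div_self h, one_div, Real.logb_inv]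
          ring
    rw [Finset.sum_congr rfl fun ω _ => hterm ω]
    simp_rw [Fintype.sum_prod_type, Fintype.sum_bool]
    simp only [if_true, Bool.false_eq_true, if_false, add_zero]
    simp_rw [← Finset.mul_sum, ← Finset.sum_mul, hR1, one_mul]
    rw [hHS, mul_comm a]
  · have hHX : entropy P Prod.snd = ∑ ω, (T ω).toReal * -Real.logb 2 (m (C ω).2) := by
      rw [hm, ← hTC, entropy_map, entropy_eq_sum, prob_map]
    -- Outcome by outcome, `-log m(x)` splits into the information density and a residual
    -- uncertainty, which is present only on erasure.
    have hterm : ∀ ω : 𝒮 × (𝒮 → 𝒳) × Bool, (T ω).toReal * -Real.logb 2 (m (C ω).2) =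
        (T ω).toReal * Real.logb 2
        (prob T (fun ω => ((C ω).2, U ω)) ((C ω).2, U ω) /
          (prob T (fun ω => (C ω).2) (C ω).2 * prob T U (U ω))) +
        if ω.2.2 then 0 else π ω.1 * -Real.logb 2 (κ ω.2.1 (ω.2.1 ω.1)) * (R ω.2.1 * (1 - a)) := by
      rintro ⟨s, z, b⟩
      have hmz : 0 < (T (s, z, b)).toReal → 0 < m (z s) := fun h => by
        have := prob_pos T (fun ω => (C ω).2) h
        rwa [hX] at this
      rw [hX]
      rw [hT] at hmz ⊢
      dsimp only [hC] at hmz ⊢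
      cases b
      · have h1 : U (s, z, false) = (z, none) := by simp [hU]
        rw [h1, hXUn, hUn]
        simp only [he, Bool.false_eq_true, if_false] at hmz ⊢
        by_cases h : π s * (R z * (1 - a)) = 0
        · rw [h]
          rcases mul_eq_zero.1 h with h | h <;> simp [h]
        · have h2 : R z * (1 - a) ≠ 0 := right_ne_zero_of_mul h
          have h3 : 0 < π s := (hπ0 s).lt_of_ne' (left_ne_zero_of_mul h)
          have h4 : 0 < m (z s) := hmz ((mul_nonneg (hπ0 s)
            (mul_nonneg (hR0 z) (sub_nonneg.2 ha1))).lt_of_ne' h)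
          have h5 : 0 < κ z (z s) := h3.trans_le (hκπ s z)
          rw [mul_div_mul_right _ _ h2, Real.logb_div h5.ne' h4.ne']
          ring
      · have h1 : U (s, z, true) = (z, some s) := by simp [hU]
        rw [h1, hXUs, hUs]
        simp only [he, if_true, add_zero]
        by_cases h : π s * (R z * a) = 0
        · simp [h]
        · rw [mul_comm (m _), div_mul_eq_div_div, div_self h, one_div, Real.logb_inv]
    rw [hHX, Finset.sum_congr rfl fun ω _ => hterm ω, Finset.sum_add_distrib, hV, mutualInfo_map,
      mutualInfo_eq_sum]
    refine add_le_add le_rfl ?_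
    have hsum : ∑ ω : 𝒮 × (𝒮 → 𝒳) × Bool, (if ω.2.2 then 0 else
        π ω.1 * -Real.logb 2 (κ ω.2.1 (ω.2.1 ω.1)) * (R ω.2.1 * (1 - a))) =
        (1 - a) * ∑ z, R z * ∑ s, π s * -Real.logb 2 (κ z (z s)) := by
      simp_rw [Fintype.sum_prod_type, Fintype.sum_bool]
      simp only [if_true, Bool.false_eq_true, if_false, zero_add]
      rw [Finset.sum_comm, Finset.mul_sum]
      refine Finset.sum_congr rfl fun z _ => ?_
      rw [← Finset.sum_mul]
      ring
    rw [hsum]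
    have hκ1 : ∀ s z, κ z (z s) ≤ 1 := by
      intro s z
      rw [← hπ1]
      exact Finset.sum_le_sum fun s' _ => by split_ifs <;> simp [hπ0]
    have hnn : ∀ s z, 0 ≤ -Real.logb 2 (κ z (z s)) := fun s z =>
      neg_nonneg.2 (Real.logb_nonpos one_lt_two ((hπ0 s).trans (hκπ s z)) (hκ1 s z))
    have hle : (1 - a) * ∑ z, R z * ∑ s, π s * -Real.logb 2 (κ z (z s)) ≤
        ∑ z, R z * ∑ s, π s * -Real.logb 2 (κ z (z s)) := by
      refine mul_le_of_le_one_left ?_ (by linarith)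
      exact Finset.sum_nonneg fun z _ => mul_nonneg (hR0 z)
        (Finset.sum_nonneg fun s _ => mul_nonneg (hπ0 s) (hnn s z))
    refine hle.trans (le_min ?_ ?_)
    -- `z(S)` is a function of `S`, so its atoms are at least as heavy as those of `S`: this is
    -- `H(X|Z) ≤ H(S)`.
    · calc ∑ z, R z * ∑ s, π s * -Real.logb 2 (κ z (z s))
          ≤ ∑ z, R z * entropy P Prod.fst := by
            refine Finset.sum_le_sum fun z _ => mul_le_mul_of_nonneg_left ?_ (hR0 z)
            rw [hHS]
            refine Finset.sum_le_sum fun s _ => ?_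
            rcases (hπ0 s).eq_or_lt with h | h
            · simp [← h]
            · exact mul_le_mul_of_nonneg_left
                (neg_le_neg (Real.logb_le_logb_of_le one_lt_two h (hκπ s z))) h.le
        _ = entropy P Prod.fst := by rw [← Finset.sum_mul, hR1, one_mul]
    · have hneg : ∀ z, ∑ s, π s * -Real.logb 2 (κ z (z s)) =
          (∑ y, Real.negMulLog (κ z y)) / Real.log 2 := by
        intro z
        have h1 : ∀ y, Real.negMulLog (κ z y) = ∑ s, if z s = y then π s * -Real.log (κ z y) else 0
            := fun y => by
          rw [Real.negMulLog, neg_mul, ← mul_neg]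
          nth_rewrite 1 [hκ]
          rw [Finset.sum_mul]
          exact Finset.sum_congr rfl fun s _ => by split_ifs <;> simp
        simp_rw [h1]
        rw [Finset.sum_comm, Finset.sum_div]
        refine Finset.sum_congr rfl fun s _ => ?_
        rw [Finset.sum_ite_eq, if_pos (Finset.mem_univ _), Real.logb]
        ring
      simp_rw [hneg, ← mul_div_assoc]
      rw [← Finset.sum_div, div_le_iff₀ hln]
      refine hRH.trans ?_
      rw [mul_comm]
      -- The functional representation gives the constant 2 and no term `I` beyond the first, so the
      -- constant 4 leaves slack.
      exact mul_le_mul_of_nonneg_right (by linarith) hln.le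

end Letter

/-! ### Additivity over independent coordinates. -/

section Product

variable {ι : Type*} [Fintype ι] [DecidableEq ι] {τ σ ρ : ι → Type*} [∀ i, Fintype (τ i)]

/-- The law of a family of independent variables with laws `Q i`. -/
noncomputable def prodPMF (Q : ∀ i, PMF (τ i)) : PMF (∀ i, τ i) :=
  PMF.ofFintype (fun t => ∏ i, Q i (t i)) (by
    have h := Finset.prod_univ_sum (fun i => (Finset.univ : Finset (τ i))) fun i x => Q i x
    rw [Fintype.piFinset_univ] at h
    rw [← h]
    refine Finset.prod_eq_one fun i _ => ?_
    rw [← tsum_fintype (L := .unconditional _), (Q i).tsum_coe])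

theorem prodPMF_apply (Q : ∀ i, PMF (τ i)) (t : ∀ i, τ i) : prodPMF Q t = ∏ i, Q i (t i) := rfl

theorem prodPMF_map (Q : ∀ i, PMF (τ i)) (g : ∀ i, τ i → σ i) (c : ∀ i, σ i) :
    (prodPMF Q).map (fun t i => g i (t i)) c = ∏ i, (Q i).map (g i) (c i) := by
  classical
  have h := Finset.prod_univ_sum (fun i => (Finset.univ : Finset (τ i)))
    fun i x => if c i = g i x then Q i x else 0
  rw [Fintype.piFinset_univ] at h
  simp_rw [PMF.map_apply, tsum_fintype]
  rw [h]
  refine Finset.sum_congr rfl fun t _ => ?_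
  by_cases hc : c = fun i => g i (t i)
  · simp [hc, prodPMF_apply]
  · rw [if_neg hc]
    obtain ⟨i, hi⟩ := Function.ne_iff.1 hc
    exact (Finset.prod_eq_zero (Finset.mem_univ i) (if_neg hi)).symm

theorem prodPMF_map_eval (Q : ∀ i, PMF (τ i)) (j : ι) :
    (prodPMF Q).map (fun t => t j) = Q j := by
  classical
  ext c
  -- The constraint on coordinate `j` is put into its factor, so the sum over vectors becomes a
  -- product in which every other factor sums to one.
  set F : ∀ i, τ i → ENNReal :=
    Function.update (fun i x => Q i x) j fun x => if c = x then Q j x else 0 with hF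
  have hFj : F j = fun x => if c = x then Q j x else 0 := Function.update_self ..
  have hFi : ∀ i, i ≠ j → F i = fun x => Q i x := fun i hi => Function.update_of_ne hi ..
  have h := Finset.prod_univ_sum (fun i => (Finset.univ : Finset (τ i))) F
  rw [Fintype.piFinset_univ] at h
  rw [PMF.map_apply, tsum_fintype]
  have h1 : ∀ t : ∀ i, τ i, (if c = t j then prodPMF Q t else 0) = ∏ i, F i (t i) := by
    intro t
    have h2 : ∏ i ∈ Finset.univ.erase j, F i (t i) = ∏ i ∈ Finset.univ.erase j, Q i (t i) :=
      Finset.prod_congr rfl fun i hi => by rw [hFi i (Finset.ne_of_mem_erase hi)]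
    rw [prodPMF_apply, ← Finset.mul_prod_erase _ (fun i => F i (t i)) (Finset.mem_univ j),
      ← Finset.mul_prod_erase _ (fun i => Q i (t i)) (Finset.mem_univ j), h2, hFj]
    by_cases hc : c = t j <;> simp [hc]
  rw [Finset.sum_congr rfl fun t _ => h1 t, ← h,
    Finset.prod_eq_single j (fun i _ hi => by
      rw [hFi i hi, ← tsum_fintype (L := .unconditional _), (Q i).tsum_coe]) (by simp), hFj]
  simp

theorem prob_prodPMF (Q : ∀ i, PMF (τ i)) (g : ∀ i, τ i → σ i) (c : ∀ i, σ i) :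
    prob (prodPMF Q) (fun t i => g i (t i)) c = ∏ i, prob (Q i) (g i) (c i) := by
  rw [prob, prodPMF_map, ENNReal.toReal_prod]
  rfl

theorem prob_prodPMF_pair (Q : ∀ i, PMF (τ i)) (g : ∀ i, τ i → σ i) (k : ∀ i, τ i → ρ i)
    (c : ∀ i, σ i) (d : ∀ i, ρ i) :
    prob (prodPMF Q) (fun t => ((fun i => g i (t i)), fun i => k i (t i))) (c, d) =
      ∏ i, prob (Q i) (fun x => (g i x, k i x)) (c i, d i) := by
  rw [← prob_prodPMF Q (fun i x => (g i x, k i x)) fun i => (c i, d i)]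
  refine prob_comp_injective (prodPMF Q) (fun t i => (g i (t i), k i (t i)))
    (g := fun e : ∀ i, σ i × ρ i => ((fun i => (e i).1), fun i => (e i).2)) ?_ fun i => (c i, d i)
  intro e e' h
  rw [Prod.mk.injEq] at h
  funext i
  exact Prod.ext (congrFun h.1 i) (congrFun h.2 i)

theorem sum_prodPMF_mul (Q : ∀ i, PMF (τ i)) (j : ι) (F : τ j → ℝ) :
    ∑ t, (prodPMF Q t).toReal * F (t j) = ∑ x, (Q j x).toReal * F x := by
  rw [← tsum_prob_mul (prodPMF Q) (fun t => t j) F, tsum_fintype]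
  simp_rw [prob, prodPMF_map_eval]

theorem toReal_pos_of_prodPMF (Q : ∀ i, PMF (τ i)) {t : ∀ i, τ i}
    (h : 0 < (prodPMF Q t).toReal) (i : ι) : 0 < (Q i (t i)).toReal := by
  rw [prodPMF_apply, ENNReal.toReal_prod] at h
  exact ENNReal.toReal_nonneg.lt_of_ne' (Finset.prod_ne_zero_iff.1 h.ne' i (Finset.mem_univ i))

theorem entropy_prodPMF (Q : ∀ i, PMF (τ i)) (g : ∀ i, τ i → σ i) :
    entropy (prodPMF Q) (fun t i => g i (t i)) = ∑ i, entropy (Q i) (g i) := by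
  rw [entropy_eq_sum]
  have h : ∀ t : ∀ i, τ i, (prodPMF Q t).toReal *
      -Real.logb 2 (prob (prodPMF Q) (fun t i => g i (t i)) fun i => g i (t i)) =
      ∑ i, (prodPMF Q t).toReal * -Real.logb 2 (prob (Q i) (g i) (g i (t i))) := by
    intro t
    rcases (ENNReal.toReal_nonneg (a := prodPMF Q t)).eq_or_lt with h | h
    · simp [← h]
    · have hpos := toReal_pos_of_prodPMF Q h
      rw [← Finset.mul_sum, prob_prodPMF, Finset.sum_neg_distrib,
        Real.logb_prod _ _ fun i _ => (prob_pos (Q i) (g i) (hpos i)).ne']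
  rw [Finset.sum_congr rfl fun t _ => h t, Finset.sum_comm]
  refine Finset.sum_congr rfl fun i _ => ?_
  rw [sum_prodPMF_mul Q i fun x => -Real.logb 2 (prob (Q i) (g i) (g i x)), entropy_eq_sum]

theorem mutualInfo_prodPMF (Q : ∀ i, PMF (τ i)) (g : ∀ i, τ i → σ i) (k : ∀ i, τ i → ρ i) :
    mutualInfo (prodPMF Q) (fun t i => g i (t i)) (fun t i => k i (t i)) =
      ∑ i, mutualInfo (Q i) (g i) (k i) := by
  rw [mutualInfo_eq_sum]
  set G : ∀ i, τ i → ℝ := fun i x => prob (Q i) (fun x => (g i x, k i x)) (g i x, k i x) /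
    (prob (Q i) (g i) (g i x) * prob (Q i) (k i) (k i x)) with hG
  have h : ∀ t : ∀ i, τ i, (prodPMF Q t).toReal *
      Real.logb 2 (prob (prodPMF Q) (fun t => ((fun i => g i (t i)), fun i => k i (t i)))
        ((fun i => g i (t i)), fun i => k i (t i)) /
        (prob (prodPMF Q) (fun t i => g i (t i)) (fun i => g i (t i)) *
          prob (prodPMF Q) (fun t i => k i (t i)) fun i => k i (t i))) =
      ∑ i, (prodPMF Q t).toReal * Real.logb 2 (G i (t i)) := by
    intro t
    rcases (ENNReal.toReal_nonneg (a := prodPMF Q t)).eq_or_lt with h | h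
    · simp [← h]
    · have hpos := toReal_pos_of_prodPMF Q h
      rw [← Finset.mul_sum, prob_prodPMF_pair, prob_prodPMF, prob_prodPMF,
        ← Finset.prod_mul_distrib, ← Finset.prod_div_distrib, Real.logb_prod]
      intro i _
      exact (div_pos (prob_pos (Q i) (fun x => (g i x, k i x)) (hpos i))
        (mul_pos (prob_pos (Q i) (g i) (hpos i)) (prob_pos (Q i) (k i) (hpos i)))).ne'
  rw [Finset.sum_congr rfl fun t _ => h t, Finset.sum_comm]
  refine Finset.sum_congr rfl fun i _ => ?_
  rw [sum_prodPMF_mul Q i fun x => Real.logb 2 (G i x), mutualInfo_eq_sum]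

end Product

/-! ### Selection tasks as coordinatewise masks. -/

section Tasks

variable {N : ℕ} {𝒳 : Fin N → Finset ℝ}

open Classical in
/-- The component `x` of index `j` when `j ∈ C`, and an erasure symbol otherwise. -/
noncomputable def mask {α : Type*} (C : Finset (Fin N)) (j : Fin N) (x : α) : Option α :=
  if j ∈ C then some x else none

/-- A selection matrix only permutes and hides coordinates, so the task and the masked vector induce
the same partition, which is all that mutual information sees. The mask acts coordinatewise, as
additivity requires. -/
theorem task_eq_iff {A : Matrix (Fin N) (Fin N) ℝ} (hA : IsSelection A) (x x' : ∀ i, 𝒳 i) :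
    task A x = task A x' ↔
      (fun j => mask (selected A) j (x j)) = fun j => mask (selected A) j (x' j) := by
  classical
  have hrow : ∀ (v : ∀ i, 𝒳 i) r c, A r c ≠ 0 → task A v r = v c := by
    intro v r c h
    change ∑ c', A r c' * (v c' : ℝ) = _
    rw [Finset.sum_eq_single c, hA.eq_one r c h, one_mul]
    · intro c' _ hc'
      by_contra hne
      exact hc' (hA.row r c' c (left_ne_zero_of_mul hne) h)
    · simp
  constructor
  · intro h
    funext j
    by_cases hj : j ∈ selected A
    · simp only [mask, hj, if_true]
      obtain ⟨r, hr⟩ := (Finset.mem_filter.1 hj).2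
      have h1 := congrFun h r
      rw [hrow x r j hr, hrow x' r j hr] at h1
      rw [Subtype.ext h1]
    · simp [mask, hj]
  · intro h
    funext r
    by_cases hr : ∃ c, A r c ≠ 0
    · obtain ⟨c, hc⟩ := hr
      have hj : c ∈ selected A := Finset.mem_filter.2 ⟨Finset.mem_univ _, r, hc⟩
      have h1 := congrFun h c
      simp only [mask, hj, if_true, Option.some_inj] at h1
      rw [hrow x r c hc, hrow x' r c hc, h1]
    · push Not at hr
      simp [task, Matrix.mulVec, dotProduct, hr]


theorem mutualInfo_mask {Ω α β : Type*} [Fintype Ω] (Q : PMF Ω) (C : Finset (Fin N)) (j : Fin N)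
    (A : Ω → α) (B : Ω → β) [Decidable (j ∈ C)] :
    mutualInfo Q (fun q => mask C j (A q)) B = if j ∈ C then mutualInfo Q A B else 0 := by
  split_ifs with h
  · simp only [mask, h, if_true]
    exact mutualInfo_comp_injective_left Q A B (Option.some_injective _)
  · simp only [mask, h, if_false]
    exact mutualInfo_const_left Q none B

theorem entropy_mask {Ω α : Type*} [Fintype Ω] (Q : PMF Ω) (C : Finset (Fin N)) (j : Fin N)
    (A : Ω → α) [Decidable (j ∈ C)] :
    entropy Q (fun q => mask C j (A q)) = if j ∈ C then entropy Q A else 0 := by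
  split_ifs with h
  · simp only [mask, h, if_true]
    rw [entropy_eq_sum, entropy_eq_sum]
    refine Finset.sum_congr rfl fun ω _ => ?_
    rw [prob_comp_injective Q A (Option.some_injective _)]
  · simp only [mask, h, if_false]
    exact entropy_const Q none

end Tasks

/-! ### From letters to vectors. -/

section Assembly

variable {N : ℕ} {𝒮 : Fin N → Type*} {𝒳 : Fin N → Finset ℝ}

/-- The law of the pair `(S_j, X_j)`. -/
noncomputable def letterLaw (P : PMF (Source 𝒮 𝒳)) (j : Fin N) : PMF (𝒮 j × 𝒳 j) :=
  P.map fun ω => (ω.1 j, ω.2 j)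

theorem letterInfo_eq (P : PMF (Source 𝒮 𝒳)) (j : Fin N) :
    mutualInfo (letterLaw P j) Prod.fst Prod.snd = pairInfo P j := mutualInfo_map ..

theorem map_apply_of_injective {Ω α : Type*} (P : PMF Ω) {g : Ω → α} (hg : Function.Injective g)
    (ω : Ω) : P.map g (g ω) = P ω := by
  classical
  rw [PMF.map_apply, tsum_eq_single ω]
  · simp
  · intro ω' h
    rw [if_neg fun h' => h (hg h').symm]

variable [∀ i, Fintype (𝒮 i)]

theorem IndependentPairs.map_eq_prodPMF {P : PMF (Source 𝒮 𝒳)} (hP : IndependentPairs P) :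
    P.map (fun ω i => (ω.1 i, ω.2 i)) = prodPMF (letterLaw P) := by
  ext t
  have hinj : Function.Injective fun (ω : Source 𝒮 𝒳) i => (ω.1 i, ω.2 i) := fun ω ω' h =>
    Prod.ext (funext fun i => congrArg Prod.fst (congrFun h i))
      (funext fun i => congrArg Prod.snd (congrFun h i))
  exact (map_apply_of_injective P hinj (fun i => (t i).1, fun i => (t i).2)).trans (hP _ _)

theorem IndependentPairs.entropy_eq {P : PMF (Source 𝒮 𝒳)} (hP : IndependentPairs P)
    {σ : Fin N → Type*} (g : ∀ i, 𝒮 i × 𝒳 i → σ i) :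
    entropy P (fun ω i => g i (ω.1 i, ω.2 i)) = ∑ i, entropy (letterLaw P i) (g i) := by
  rw [← entropy_prodPMF, ← hP.map_eq_prodPMF, entropy_map]

theorem IndependentPairs.mutualInfo_eq {P : PMF (Source 𝒮 𝒳)} (hP : IndependentPairs P)
    {σ ρ : Fin N → Type*} (g : ∀ i, 𝒮 i × 𝒳 i → σ i) (k : ∀ i, 𝒮 i × 𝒳 i → ρ i) :
    mutualInfo P (fun ω i => g i (ω.1 i, ω.2 i)) (fun ω i => k i (ω.1 i, ω.2 i)) =
      ∑ i, mutualInfo (letterLaw P i) (g i) (k i) := by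
  rw [← mutualInfo_prodPMF, ← hP.map_eq_prodPMF, mutualInfo_map]

/-- The letterwise kernel, with its values encoded as natural numbers. -/
noncomputable def letterwise {𝒰 : Fin N → Type*} [∀ j, Fintype (𝒰 j)]
    (V : ∀ j, 𝒮 j × 𝒳 j → PMF (𝒰 j)) (enc : ∀ j, 𝒰 j → ℕ) (ω : Source 𝒮 𝒳) :
    PMF (Fin N → ℕ) :=
  (prodPMF fun j => V j (ω.1 j, ω.2 j)).map fun u j => enc j (u j)

theorem IndependentPairs.jointLaw_map_eq_prodPMF {P : PMF (Source 𝒮 𝒳)} (hP : IndependentPairs P)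
    {𝒰 : Fin N → Type*} [∀ j, Fintype (𝒰 j)] (V : ∀ j, 𝒮 j × 𝒳 j → PMF (𝒰 j)) :
    (jointLaw P fun ω => prodPMF fun j => V j (ω.1 j, ω.2 j)).map
      (fun q i => ((q.1.1 i, q.1.2 i), q.2 i)) =
      prodPMF fun i => jointLaw (letterLaw P i) (V i) := by
  ext t
  have hinj : Function.Injective fun (q : Source 𝒮 𝒳 × ∀ j, 𝒰 j) i =>
      ((q.1.1 i, q.1.2 i), q.2 i) := fun q q' h =>
    Prod.ext (Prod.ext (funext fun i => congrArg (fun t => t.1.1) (congrFun h i))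
      (funext fun i => congrArg (fun t => t.1.2) (congrFun h i)))
      (funext fun i => congrArg Prod.snd (congrFun h i))
  refine (map_apply_of_injective _ hinj
    ((fun i => (t i).1.1, fun i => (t i).1.2), fun i => (t i).2)).trans ?_
  rw [jointLaw_apply, hP, prodPMF_apply, prodPMF_apply, ← Finset.prod_mul_distrib]
  exact Finset.prod_congr rfl fun i _ => (jointLaw_apply (letterLaw P i) (V i) _ _).symm

/-- Regrouped by coordinate, source and output form independent triples, so information adds up; the
injective encoding does not change it. -/
theorem IndependentPairs.mutualInfo_letterwise {P : PMF (Source 𝒮 𝒳)} (hP : IndependentPairs P)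
    {𝒰 : Fin N → Type*} [∀ j, Fintype (𝒰 j)] (V : ∀ j, 𝒮 j × 𝒳 j → PMF (𝒰 j))
    {enc : ∀ j, 𝒰 j → ℕ} (henc : ∀ j, Function.Injective (enc j))
    {σ : Fin N → Type*} (g : ∀ i, 𝒮 i × 𝒳 i → σ i) :
    mutualInfo (jointLaw P (letterwise V enc)) (fun q i => g i (q.1.1 i, q.1.2 i))
        (fun q => q.2) =
      ∑ i, mutualInfo (jointLaw (letterLaw P i) (V i)) (fun q => g i q.1) (fun q => q.2) := by
  have hencp : Function.Injective fun (u : ∀ j, 𝒰 j) j => enc j (u j) := fun u u' h =>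
    funext fun j => henc j (congrFun h j)
  have h1 : jointLaw P (letterwise V enc) =
      (jointLaw P fun ω => prodPMF fun j => V j (ω.1 j, ω.2 j)).map
        fun q => (q.1, fun j => enc j (q.2 j)) := by
    rw [← jointLaw_map_right P (fun ω => prodPMF fun j => V j (ω.1 j, ω.2 j))
      fun u j => enc j (u j)]
    rfl
  have h2 := mutualInfo_prodPMF (fun i => jointLaw (letterLaw P i) (V i)) (fun i q => g i q.1)
    fun i q => q.2
  rw [← hP.jointLaw_map_eq_prodPMF, mutualInfo_map] at h2
  rw [← h2, h1, mutualInfo_map]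
  exact mutualInfo_comp_injective_right _ (fun q i => g i (q.1.1 i, q.1.2 i))
    (fun q : Source 𝒮 𝒳 × ∀ j, 𝒰 j => q.2) hencp

theorem letterEntropy_eq (P : PMF (Source 𝒮 𝒳)) (j : Fin N) :
    entropy (letterLaw P j) Prod.fst = pairInfo P j + pairCondEntropy P j := by
  rw [letterLaw, entropy_map, pairInfo, pairCondEntropy, mutualInfo_add_condEntropy]

theorem IndependentPairs.mutualInfo_task {P : PMF (Source 𝒮 𝒳)} (hP : IndependentPairs P)
    {A : Matrix (Fin N) (Fin N) ℝ} (hA : IsSelection A) :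
    mutualInfo P (fun ω => ω.1) (fun ω => task A ω.2) = ∑ j ∈ selected A, pairInfo P j := by
  classical
  rw [mutualInfo_comm, mutualInfo_congr_left P _ fun ω ω' => task_eq_iff hA ω.2 ω'.2,
    hP.mutualInfo_eq (fun j q => mask (selected A) j q.2) fun i q => q.1]
  simp_rw [mutualInfo_mask]
  rw [Finset.sum_ite_mem, Finset.univ_inter]
  refine Finset.sum_congr rfl fun j _ => ?_
  rw [mutualInfo_comm]
  exact letterInfo_eq P j

theorem gapOne_eq {P : PMF (Source 𝒮 𝒳)} (hP : IndependentPairs P)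
    {A : Matrix (Fin N) (Fin N) ℝ} (hA : IsSelection A) :
    gapOne P A = ∑ j ∈ selected A, (pairInfo P j + pairCondEntropy P j) := by
  rw [gapOne, hP.mutualInfo_task hA, Finset.sum_add_distrib]

theorem gapTwo_eq {P : PMF (Source 𝒮 𝒳)} (hP : IndependentPairs P)
    {A : Matrix (Fin N) (Fin N) ℝ} (hA : IsSelection A) :
    gapTwo P A = ∑ j ∈ selected A, (pairInfo P j + (Real.logb 2 (pairInfo P j + 1) + 4)) := by
  rw [gapTwo, hP.mutualInfo_task hA, ← Finset.sum_add_distrib]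

theorem leakage_jointLaw_bounds {𝒰 : Type*} (P : PMF (Source 𝒮 𝒳)) (K : Source 𝒮 𝒳 → PMF 𝒰) :
    0 ≤ leakage (jointLaw P K) ∧ leakage (jointLaw P K) ≤ entropy P fun ω => ω.1 := by
  have h := mutualInfo_nonneg_and_le_entropy (jointLaw P K) (fun q => q.1.1) fun q => q.2
  have h1 : entropy (jointLaw P K) (fun q => q.1.1) = entropy P fun ω => ω.1 := by
    conv_rhs => rw [← jointLaw_map_fst P K, entropy_map]
  rw [h1] at h
  exact h

/-- Utility is at most the entropy of the masked source, which is additive. Nothing about the kernel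
is used, so the bound covers every disclosure. -/
theorem utility_jointLaw_le {𝒰 : Type*} {P : PMF (Source 𝒮 𝒳)} (hP : IndependentPairs P)
    (K : Source 𝒮 𝒳 → PMF 𝒰) {A : Matrix (Fin N) (Fin N) ℝ} (hA : IsSelection A) :
    utility (jointLaw P K) A ≤ ∑ j ∈ selected A, entropy (letterLaw P j) Prod.snd := by
  classical
  have h1 : entropy (jointLaw P K) (fun q j => mask (selected A) j (q.1.2 j)) =
      entropy P fun ω j => mask (selected A) j (ω.2 j) := by
    conv_rhs => rw [← jointLaw_map_fst P K, entropy_map]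
  rw [utility, mutualInfo_congr_left _ _ fun q q' => task_eq_iff hA q.1.2 q'.1.2]
  refine (mutualInfo_nonneg_and_le_entropy _ _ _).2.trans_eq ?_
  rw [h1, hP.entropy_eq fun j q => mask (selected A) j q.2]
  simp_rw [entropy_mask]
  rw [Finset.sum_ite_mem, Finset.univ_inter]

end Assembly
end SemanticPrivacy

open SemanticPrivacy in
/-- `K` is the kernel `P_{U* | X S}` and `V i` is the kernel `P_{U*_i | X_i S_i}`; the discrete random
variables `U*_i` are taken with values in `ℕ`. -/
theorem theorem2 {N L : ℕ} {𝒮 : Fin N → Type*} [∀ i, Fintype (𝒮 i)] {𝒳 : Fin N → Finset ℝ}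
    (P : PMF (Source 𝒮 𝒳)) (hP : IndependentPairs P)
    (f : (∀ i, 𝒳 i) → ℝ)
    (A : Fin L → Matrix (Fin N) (Fin N) ℝ) (hA : ∀ i, IsSelection (A i))
    (ε : ℝ) (W : (∀ i, 𝒮 i) → ℝ → (Fin L → Fin N → ℝ) → PMF ℝ)
    (hW : Feasible P f A ε W) :
    (∃ (K : Source 𝒮 𝒳 → PMF (Fin N → ℕ)) (V : ∀ i, 𝒳 i → 𝒮 i → PMF ℕ),
      (∀ (s : ∀ i, 𝒮 i) (x : ∀ i, 𝒳 i) (u : Fin N → ℕ),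
        K (s, x) u = ∏ i, V i (x i) (s i) (u i)) ∧
      leakage (jointLaw P K) = leakage (disclosure P f A W) ∧
      ∀ i : Fin L,
        utility (disclosure P f A W) (A i) ≤
          utility (jointLaw P K) (A i) + min (gapOne P (A i)) (gapTwo P (A i))) ∧
    ∀ i : Fin L,
      gapOne P (A i) = ∑ j ∈ selected (A i), (pairInfo P j + pairCondEntropy P j) ∧
      gapTwo P (A i) =
        ∑ j ∈ selected (A i), (pairInfo P j + (Real.logb 2 (pairInfo P j + 1) + 4)) := by
  refine ⟨?_, fun i => ⟨gapOne_eq hP (hA i), gapTwo_eq hP (hA i)⟩⟩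
  classical
  obtain ⟨hl0, hl1⟩ : 0 ≤ leakage (disclosure P f A W) ∧
      leakage (disclosure P f A W) ≤ entropy P fun ω => ω.1 := leakage_jointLaw_bounds P _
  have hut : ∀ i, utility (disclosure P f A W) (A i) ≤
      ∑ j ∈ selected (A i), entropy (letterLaw P j) Prod.snd :=
    fun i => utility_jointLaw_le hP _ (hA i)
  set l := leakage (disclosure P f A W) with hl
  set H := entropy P fun ω => ω.1 with hH
  have hHsum : H = ∑ j, entropy (letterLaw P j) Prod.fst := hP.entropy_eq fun j q => q.1
  -- If `H = 0` then `l = 0`, and the default value `l / 0 = 0` is a valid fraction.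
  have haH : l / H * H = l := by
    rcases eq_or_ne H 0 with h | h
    · rw [h, mul_zero]
      exact le_antisymm hl0 (hl1.trans h.le)
    · exact div_mul_cancel₀ _ h
  -- Every letter uses the same revealing probability `a = l / H`, so the leakages add up to `a * H
  -- = l`.
  choose V hVS hVX using fun j => exists_letter_kernel (letterLaw P j)
    (div_nonneg hl0 (hl0.trans hl1)) (div_le_one_of_le₀ hl1 (hl0.trans hl1))
  choose enc henc using fun j => Countable.exists_injective_nat ((𝒮 j → 𝒳 j) × Option (𝒮 j))
  refine ⟨letterwise V enc, fun j x s => (V j (s, x)).map (enc j), fun s x u => ?_, ?_, fun i => ?_⟩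
  · exact prodPMF_map _ enc u
  · rw [leakage, hP.mutualInfo_letterwise V henc fun j q => q.1, Finset.sum_congr rfl fun j _ => hVS j,
      ← Finset.mul_sum, ← hHsum, haH]
  · have hu : utility (jointLaw P (letterwise V enc)) (A i) = ∑ j ∈ selected (A i),
        mutualInfo (jointLaw (letterLaw P j) (V j)) (fun q => q.1.2) (fun q => q.2) := by
      rw [utility, mutualInfo_congr_left _ _ fun q q' => task_eq_iff (hA i) q.1.2 q'.1.2,
        hP.mutualInfo_letterwise V henc fun j q => mask (selected (A i)) j q.2]
      simp_rw [mutualInfo_mask]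
      rw [Finset.sum_ite_mem, Finset.univ_inter]
    have hsum := (hut i).trans (Finset.sum_le_sum fun j _ => hVX j)
    rw [Finset.sum_add_distrib, ← hu] at hsum
    -- The letterwise minima sum to at most either of the two total gaps.
    refine hsum.trans (add_le_add le_rfl (le_min ?_ ?_))
    · rw [gapOne_eq hP (hA i)]
      exact Finset.sum_le_sum fun j _ => (min_le_left _ _).trans_eq (letterEntropy_eq P j)
    · rw [gapTwo_eq hP (hA i)]
      refine Finset.sum_le_sum fun j _ => (min_le_right _ _).trans_eq ?_
      rw [letterInfo_eq]
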